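/- Let $d$ be a positive integer. Definitions. For a positive integer $p$, let $H_\infty(d,p)=\sum_{v}[0,1]\,v$ be the Minkowski sum over all $v\in\mathbb Z^d$ with $\|v\|_\infty\le p$, $\gcd(v)=1$, and first nonzero coordinate positive; let $m(d,p)$ be its number of vertices. A set $S\subset\{0,1\}^n$ is called a matroid if it is the set of indicators of the bases of a matroid on $\{1,\dots,n\}$. A matrix $W\in\mathbb Z^{d\times n}$ is $p$-bounded if its entries are in $\{0,1,\dots,p\}$; $\operatorname{conv}(WS)=\operatorname{conv}\{Wx:x\in S\}\subset\mathbb R^d$. The normal cone of a polytope $P$ at a vertex $v$ is the set of vectors $h$ such that $v$ is the unique maximizer of $hx$ over $P$; a polytope $H$ refines a polytope $P$ if the normal cone of $H$ at every vertex of $H$ is contained in the normal cone of $P$ at some vertex of $P$. (1) For all positive integers $p,n$, every matroid $S\subset\{0,1\}^n$ and every $p$-bounded $W\in\mathbb Z^{d\times n}$, $H_\infty(d,p)$ refines $\operatorname{conv}(WS)$. (2) For every positive integer $p$ there are a positive integer $n$, a matroid $S\subset\{0,1\}^n$ and a $p$-bounded $W\in\mathbb Z^{d\times n}$ such that $H_\infty(d,p)$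 is a translate of $\operatorname{conv}(WS)$. (3) For every positive integer $p$, the maximum number of vertices of $\operatorname{conv}(WS)$ over all positive integers $n$, all matroids $S\subset\{0,1\}^n$ and all $p$-bounded $W\in\mathbb Z^{d\times n}$ is attained and equals $m(d,p)$. (4) There is an algorithm (depending only on $d$) which, given any positive integers $n,p$, a $p$-bounded $W\in\mathbb Z^{d\times n}$, a matroid $S\subset\{0,1\}^n$ presented by an independence oracle (is $y\le x$ for some $x\in S$?), and a convex $f:\mathbb R^d\to\mathbb R$ presented by a comparison oracle (is $f(x)<f(y)$, for $x,y\in\mathbb Z^d$?), finds an $x\in S$ that maximizes $f(Wx)$ over $S$, using a number of arithmetic operations and oracle queries that is bounded by a polynomial in $n$ and $p$. It accesses $S$ only by solving exactly $m(d,p)$ linear problems $\max\{wx:x\in S\}$ with $w\in\mathbb Z^n$, by a subroutine that, for every positive integer $n$, every matroid $S\subset\{0,1\}^n$ and every $w\in\mathbb Z^n$, finds an optimal basis that is an output of the greedy algorithm (consider the elements in an order of nonincreasing utility, and add each one that keeps the set independent), within a number of operations and queries that is polynomial in $n$. -/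

import Mathlib

noncomputable section

open Classical in
/-- The generators of the primitive zonotope `H_∞(d,p)`: the integer vectors of sup-norm at most
`p` whose entries have greatest common divisor `1` and whose first nonzero entry is positive. -/
def primitiveGenerators (d p : ℕ) : Finset (Fin d → ℤ) :=
  (Finset.Icc (fun _ => -(p : ℤ)) (fun _ => (p : ℤ))).filter fun v =>
    Finset.univ.gcd v = 1 ∧ ∃ i, 0 < v i ∧ ∀ j < i, v j = 0

/-- An integer vector regarded as a real vector. -/
def realVec {d : ℕ} (v : Fin d → ℤ) : Fin d → ℝ := fun i => (v i : ℝ)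

open scoped Pointwise in
/-- The primitive zonotope `H_∞(d,p)`, the Minkowski sum of the segments `[0,1] v` over its
generators `v`. -/
def primitiveZonotope (d p : ℕ) : Set (Fin d → ℝ) :=
  ∑ v ∈ primitiveGenerators d p, segment ℝ 0 (realVec v)

/-- The vertices of a polytope. -/
def vertices {d : ℕ} (P : Set (Fin d → ℝ)) : Set (Fin d → ℝ) := P.extremePoints ℝ

/-- `m(d,p)`, the number of vertices of `H_∞(d,p)`. -/
def numVertices (d p : ℕ) : ℕ := (vertices (primitiveZonotope d p)).ncard

/-- The normal cone of `P` at `v`: the vectors `h` such that `v` is the unique maximizer of `h`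
over `P`. -/
def normalCone {d : ℕ} (P : Set (Fin d → ℝ)) (v : Fin d → ℝ) : Set (Fin d → ℝ) :=
  {h | ∀ x ∈ P, x ≠ v → dotProduct h x < dotProduct h v}

/-- `H` refines `P`: the normal cone of `H` at every vertex of `H` is contained in the normal cone
of `P` at some vertex of `P`. -/
def Refines {d : ℕ} (H P : Set (Fin d → ℝ)) : Prop :=
  ∀ v ∈ vertices H, ∃ u ∈ vertices P, normalCone H v ⊆ normalCone P u

/-- `S ⊆ {0,1}ⁿ` is a matroid: it is the set of the indicators of the bases of a matroid on the
ground set `{1,…,n}`. -/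
def IsMatroid {n : ℕ} (S : Set (Fin n → ℤ)) : Prop :=
  ∃ M : Matroid (Fin n), M.E = Set.univ ∧
    S = {x | ∃ B : Set (Fin n), M.IsBase B ∧ x = B.indicator fun _ => (1 : ℤ)}

/-- A utility matrix is `p`-bounded if its entries are in `{0,…,p}`. -/
def IsBoundedUtility {d n : ℕ} (p : ℕ) (W : Matrix (Fin d) (Fin n) ℤ) : Prop :=
  ∀ i j, 0 ≤ W i j ∧ W i j ≤ p

/-- The projection polytope `conv(WS) = conv {W x : x ∈ S}`. -/
def projPolytope {d n : ℕ} (W : Matrix (Fin d) (Fin n) ℤ) (S : Set (Fin n → ℤ)) :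
    Set (Fin d → ℝ) :=
  convexHull ℝ ((fun x => realVec (W.mulVec x)) '' S)

/-- `y` is independent in `S`: `y ≤ x` for some `x ∈ S`. -/
def Indep {n : ℕ} (S : Set (Fin n → ℤ)) (y : Fin n → ℤ) : Prop := ∃ x ∈ S, y ≤ x

open Classical in
/-- The greedy algorithm that considers the elements of the ground set in the order of the list
`L`, starts from the empty set, and adds an element whenever the result is independent. -/
def greedyAlong {n : ℕ} (S : Set (Fin n → ℤ)) (L : List (Fin n)) : Fin n → ℤ :=
  L.foldl (fun y j => if Indep S (y + Pi.single j 1) then y + Pi.single j 1 else y) 0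

/-- `x` is found by the greedy algorithm for the utility vector `w`, which considers the elements
of the ground set in an order of nonincreasing utility. -/
def IsGreedySolution {n : ℕ} (S : Set (Fin n → ℤ)) (w x : Fin n → ℤ) : Prop :=
  ∃ L : List (Fin n), L.Nodup ∧ (∀ j, j ∈ L) ∧ L.Pairwise (fun i j => w j ≤ w i) ∧
    x = greedyAlong S L

/-- `x` solves the linear optimization problem `max {w y : y ∈ S}`. -/
def SolvesLinear {n : ℕ} (S : Set (Fin n → ℤ)) (w x : Fin n → ℤ) : Prop :=
  x ∈ S ∧ ∀ y ∈ S, dotProduct w y ≤ dotProduct w x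

/-- `x` solves the multicriteria problem `max {f (W y) : y ∈ S}`. -/
def SolvesMulticriteria {d n : ℕ} (S : Set (Fin n → ℤ)) (W : Matrix (Fin d) (Fin n) ℤ)
    (f : (Fin d → ℝ) → ℝ) (x : Fin n → ℤ) : Prop :=
  x ∈ S ∧ ∀ y ∈ S, f (realVec (W.mulVec y)) ≤ f (realVec (W.mulVec x))

/-! ### Programs

Random access programs over the integers, with addition, subtraction, multiplication, comparison,
indirect addressing, bounded loops and queries. A program is one finite text for inputs of all
sizes. Loops run a number of times that is known on entry, so that every program halts. -/

/-- The memory: integer arrays named by natural numbers. -/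
abbrev Mem := ℕ → ℤ → ℤ

/-- Write the value `z` into cell `i` of array `a`. -/
def Mem.put (M : Mem) (a : ℕ) (i z : ℤ) : Mem := Function.update M a (Function.update (M a) i z)

/-- Integer expressions; `cell a e` is the content of the cell of array `a` whose index is the
value of `e`. -/
inductive Expr where
  | const (c : ℤ)
  | cell (a : ℕ) (e : Expr)
  | add (e e' : Expr)
  | sub (e e' : Expr)
  | mul (e e' : Expr)

def Expr.eval (M : Mem) : Expr → ℤ
  | .const c => c
  | .cell a e => M a (e.eval M)
  | .add e e' => e.eval M + e'.eval M
  | .sub e e' => e.eval M - e'.eval M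
  | .mul e e' => e.eval M * e'.eval M

/-- The number of operations in the evaluation of an expression. -/
def Expr.ops : Expr → ℕ
  | .const _ => 1
  | .cell _ e => e.ops + 1
  | .add e e' => e.ops + e'.ops + 1
  | .sub e e' => e.ops + e'.ops + 1
  | .mul e e' => e.ops + e'.ops + 1

/-- Programs with queries in `Q`.
* `assign a i e` writes the value of `e` into cell `i` of array `a`;
* `ifle e e' P P'` runs `P` if `e ≤ e'` and `P'` otherwise;
* `loop v e P` evaluates `e` once, to `N` say, and runs `P` for `k = 0, 1, …, N - 1` in turn, each
  time after `k` has been written into cell `0` of array `v`;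
* `ask q` makes the query `q`. -/
inductive Prog (Q : Type) where
  | nop
  | assign (a : ℕ) (i e : Expr)
  | seq (P P' : Prog Q)
  | ifle (e e' : Expr) (P P' : Prog Q)
  | loop (v : ℕ) (e : Expr) (P : Prog Q)
  | ask (q : Q)

/-- The memory after the first `N` rounds of a loop with counter `v`, where `step` is the effect of
the body. -/
def loopMem (step : Mem → Mem) (v : ℕ) (M : Mem) : ℕ → Mem
  | 0 => M
  | N + 1 => step ((loopMem step v M N).put v 0 N)

/-- The memory after a run of a program, where `O q` is the effect of the query `q`. -/
def Prog.exec {Q : Type} (O : Q → Mem → Mem) : Prog Q → Mem → Mem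
  | .nop, M => M
  | .assign a i e, M => M.put a (i.eval M) (e.eval M)
  | .seq P P', M => P'.exec O (P.exec O M)
  | .ifle e e' P P', M => if e.eval M ≤ e'.eval M then P.exec O M else P'.exec O M
  | .loop v e P, M => loopMem (P.exec O) v M (e.eval M).toNat
  | .ask q, M => O q M

/-- The total charge of a run, where every elementary operation (arithmetic operation, access to
the memory, comparison, assignment, loop round) is charged `u`, and the query `q`, made with memory
`M`, is charged `c q M`. -/
def Prog.charge {Q : Type} (O : Q → Mem → Mem) (u : ℕ) (c : Q → Mem → ℕ) : Prog Q → Mem → ℕ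
  | .nop, _ => 0
  | .assign _ i e, _ => u * (i.ops + e.ops + 1)
  | .seq P P', M => P.charge O u c M + P'.charge O u c (P.exec O M)
  | .ifle e e' P P', M => u * (e.ops + e'.ops + 1) +
      if e.eval M ≤ e'.eval M then P.charge O u c M else P'.charge O u c M
  | .loop v e P, M => u * (e.ops + 1) + ∑ k ∈ Finset.range (e.eval M).toNat,
      (u + P.charge O u c ((loopMem (P.exec O) v M k).put v 0 k))
  | .ask q, M => c q M

/-- The array that holds the vector `x` in its cells `0, …, n - 1`, and `0` elsewhere. -/
def arrayOf {n : ℕ} (x : Fin n → ℤ) : ℤ → ℤ := Function.extend (fun j : Fin n => (j : ℤ)) x 0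

/-- The vector in the cells `0, …, n - 1` of array `a`. -/
def Mem.vec (M : Mem) (n a : ℕ) : Fin n → ℤ := fun j => M a (j : ℤ)

/-- The truth value of `b` as an integer. -/
def truth (b : Prop) : ℤ := open Classical in if b then 1 else 0

/-! ### Linear optimization over a matroid given by an independence oracle -/

/-- The query of a program for linear optimization: is the vector in array `y` independent? The
answer is written into cell `0` of array `r`. -/
inductive LinQuery where
  | indep (y r : ℕ)

def linOracle {n : ℕ} (S : Set (Fin n → ℤ)) : LinQuery → Mem → Mem
  | .indep y r, M => M.put r 0 (truth (Indep S (M.vec n y)))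

/-- The input of a linear problem: array `0` holds `n` and array `1` the utility vector. -/
def linInput {n : ℕ} (w : Fin n → ℤ) : Mem
  | 0 => arrayOf ![(n : ℤ)]
  | 1 => arrayOf w
  | _ => 0

/-- The basis that the program `G` computes for the utility vector `w` over `S`; the output is
read off from array `2`. -/
def linOutput (G : Prog LinQuery) {n : ℕ} (S : Set (Fin n → ℤ)) (w : Fin n → ℤ) : Fin n → ℤ :=
  (G.exec (linOracle S) (linInput w)).vec n 2

/-- The number of elementary operations and oracle queries in this computation. -/
def linTime (G : Prog LinQuery) {n : ℕ} (S : Set (Fin n → ℤ)) (w : Fin n → ℤ) : ℕ :=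
  G.charge (linOracle S) 1 (fun _ _ => 1) (linInput w)

/-! ### Multicriteria optimization over a matroid -/

/-- The queries of a program for multicriteria optimization.
* `compare a b r` is the comparison oracle of `f`: is `f x < f y` for the vectors `x`, `y` in the
  arrays `a`, `b`? The answer is written into cell `0` of array `r`.
* `solve a r` solves the linear problem over `S` whose utility vector is in array `a`, by a
  subroutine with access to the independence oracle of `S`, and puts the basis into array `r`. -/
inductive MultiQuery where
  | compare (a b r : ℕ)
  | solve (a r : ℕ)

/-- The effect of the queries, where the subroutine is the program `G`. -/
def multiOracle (G : Prog LinQuery) {d n : ℕ} (S : Set (Fin n → ℤ)) (f : (Fin d → ℝ) → ℝ) :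
    MultiQuery → Mem → Mem
  | .compare a b r, M =>
      M.put r 0 (truth (f (realVec (M.vec d a)) < f (realVec (M.vec d b))))
  | .solve a r, M => Function.update M r (arrayOf (linOutput G S (M.vec n a)))

/-- The input of a multicriteria problem: array `0` holds `n` and `p`, and array `1` holds the
`d × n` utility matrix row by row. -/
def multiInput {d n : ℕ} (p : ℕ) (W : Matrix (Fin d) (Fin n) ℤ) : Mem
  | 0 => arrayOf ![(n : ℤ), (p : ℤ)]
  | 1 => Function.extend (fun ij : Fin d × Fin n => (ij.1 : ℤ) * n + ij.2)
      (fun ij => W ij.1 ij.2) 0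
  | _ => 0

/-- The basis that the program `A` with subroutine `G` computes; the output is read off from
array `2`. -/
def multiOutput (A : Prog MultiQuery) (G : Prog LinQuery) {d n : ℕ} (p : ℕ)
    (S : Set (Fin n → ℤ)) (W : Matrix (Fin d) (Fin n) ℤ) (f : (Fin d → ℝ) → ℝ) : Fin n → ℤ :=
  (A.exec (multiOracle G S f) (multiInput p W)).vec n 2

/-- The number of elementary operations and of queries to the oracles of `S` and `f` in this
computation, those of all the runs of the subroutine included. -/
def multiTime (A : Prog MultiQuery) (G : Prog LinQuery) {d n : ℕ} (p : ℕ)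
    (S : Set (Fin n → ℤ)) (W : Matrix (Fin d) (Fin n) ℤ) (f : (Fin d → ℝ) → ℝ) : ℕ :=
  A.charge (multiOracle G S f) 1
    (fun q M => match q with
      | .compare _ _ _ => 1
      | .solve a _ => 1 + linTime G S (M.vec n a))
    (multiInput p W)

/-- The number of linear problems that are solved in this computation. -/
def multiSolves (A : Prog MultiQuery) (G : Prog LinQuery) {d n : ℕ} (p : ℕ)
    (S : Set (Fin n → ℤ)) (W : Matrix (Fin d) (Fin n) ℤ) (f : (Fin d → ℝ) → ℝ) : ℕ :=
  A.charge (multiOracle G S f) 0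
    (fun q _ => match q with
      | .compare _ _ _ => 0
      | .solve _ _ => 1)
    (multiInput p W)

end

/-! ### Polytopes and their normal cones -/

section Polytope

variable {d : ℕ}

/-! Maximizing a functional h over conv(WS) is a linear problem over S whose utilities are the
products of h with the columns of W. Over a matroid the greedy algorithm solves it, and its run
depends only on the order of the utilities, hence only on the signs of the products of h with
differences of columns. Since W has entries in {0,…,p}, such a difference is an integer vector of
sup-norm at most p, so it is zero or a nonzero multiple of a generator of the primitive zonotope
(`exists_primitive_multiple`). The normal cone of the zonotope at a vertex is an open chamber of
vectors with prescribed nonzero signs on the generators (`zonotopeVertex_eq_iff`). Thus one greedy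
basis is optimal on a whole chamber, and because the chamber is open, its image is the unique
maximizer there (`subset_normalCone_of_isOpen`). This is the refinement
(`exists_vertex_normalCone_subset`), and it bounds the number of vertices.

The bound is attained by a partition matroid with two elements for each generator g, whose columns
are the positive and the negative part of g. Choosing one of the two columns means adding g or 0 to
the negative part, so the projection is a translated zonotope.

For the algorithm, a convex function is maximized at a vertex of the projection, and such a vertex
is found by the linear problem of any single point of a suitable chamber. By Cramer's rule every
chamber contains an integer point with entries at most d! p^d (`exists_small_chamber_point`), so for
fixed d a box of polynomial size meets every chamber. The program runs through this box and solves a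
linear problem only for the first point of each chamber, that is, once per vertex of the zonotope
(`card_representatives`).

Programs are verified with Hoare-style rules for `Prog.Meets`, which track the memory, the count of
linear problems and the running time together. The time bound is read off from the program text:
given a bound on all loop lengths and query costs, it is a polynomial in these (`Prog.bound_le`). -/

theorem realVec_add (v w : Fin d → ℤ) : realVec (v + w) = realVec v + realVec w := by
  ext i; simp [realVec]

theorem realVec_sub (v w : Fin d → ℤ) : realVec (v - w) = realVec v - realVec w := by
  ext i; simp [realVec]

theorem realVec_injective : Function.Injective (realVec : (Fin d → ℤ) → Fin d → ℝ) := by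
  intro v w h
  ext i
  have := congrFun h i
  simpa [realVec] using this

theorem dotProduct_realVec (v w : Fin d → ℤ) :
    dotProduct (realVec v) (realVec w) = ((dotProduct v w : ℤ) : ℝ) := by
  simp [dotProduct, realVec]

theorem realVec_sum {ι : Type*} (s : Finset ι) (v : ι → Fin d → ℤ) :
    realVec (∑ i ∈ s, v i) = ∑ i ∈ s, realVec (v i) := by
  ext i; simp [realVec]

theorem realVec_eq_zero {v : Fin d → ℤ} : realVec v = 0 ↔ v = 0 := by
  rw [← realVec_injective.eq_iff]
  have : realVec (0 : Fin d → ℤ) = 0 := by ext; simp [realVec]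
  rw [this]

/-- A vector that is the unique maximizer over the generators of a polytope is the unique
maximizer over the polytope. -/
theorem mem_normalCone_convexHull {F : Set (Fin d → ℝ)} {u h : Fin d → ℝ}
    (H : ∀ x ∈ F, x ≠ u → dotProduct h x < dotProduct h u) : h ∈ normalCone (convexHull ℝ F) u := by
  -- The set on the right, an open half-space with the boundary point u added, is convex. The case
  -- distinctions below are needed because a point equal to u gives only equality, and a zero weight
  -- gives no strict inequality.
  have hsub : convexHull ℝ F ⊆ {x | x ≠ u → dotProduct h x < dotProduct h u} := by
    refine convexHull_min H ?_
    intro x hx y hy a b ha hb hab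
    simp only [Set.mem_ofPred_eq] at hx hy ⊢
    intro hne
    have e : dotProduct h (a • x + b • y) = a * dotProduct h x + b * dotProduct h y := by
      simp [dotProduct_add, dotProduct_smul]
    have e2 : dotProduct h u = a * dotProduct h u + b * dotProduct h u := by
      rw [← add_mul, hab, one_mul]
    rw [e, e2]
    rcases ha.eq_or_lt with rfl | ha
    · have hb1 : b = 1 := by linarith
      subst hb1
      have : y ≠ u := by simpa using hne
      have := hy this
      linarith
    rcases hb.eq_or_lt with rfl | hb
    · have hb1 : a = 1 := by linarith
      subst hb1
      have : x ≠ u := by simpa using hne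
      have := hx this
      linarith
    by_cases hxu : x = u
    · by_cases hyu : y = u
      · exact absurd (by rw [hxu, hyu, ← add_smul, hab, one_smul]) hne
      · have := mul_lt_mul_of_pos_left (hy hyu) hb
        rw [hxu]; linarith
    · have h1 := mul_lt_mul_of_pos_left (hx hxu) ha
      by_cases hyu : y = u
      · rw [hyu]; linarith
      · have := mul_lt_mul_of_pos_left (hy hyu) hb
        linarith
  exact fun x hx hne => hsub hx hne

theorem normalCone_convexHull (F : Set (Fin d → ℝ)) (u : Fin d → ℝ) :
    normalCone (convexHull ℝ F) u = {h | ∀ x ∈ F, x ≠ u → dotProduct h x < dotProduct h u} :=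
  Set.Subset.antisymm (fun _ hh x hx => hh x (subset_convexHull ℝ F hx))
    fun _ hh => mem_normalCone_convexHull hh

theorem continuous_dotProduct_left (x : Fin d → ℝ) : Continuous fun h => dotProduct h x := by
  unfold dotProduct; fun_prop

theorem isOpen_normalCone_convexHull {F : Set (Fin d → ℝ)} (hF : F.Finite) (u : Fin d → ℝ) :
    IsOpen (normalCone (convexHull ℝ F) u) := by
  rw [normalCone_convexHull]
  have : {h : Fin d → ℝ | ∀ x ∈ F, x ≠ u → dotProduct h x < dotProduct h u} =
      ⋂ x ∈ F, {h | x ≠ u → dotProduct h x < dotProduct h u} := by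
    ext; simp
  rw [this]
  refine hF.isOpen_biInter fun x _ => ?_
  by_cases hx : x = u
  · simp [hx]
  · simpa [hx] using isOpen_lt (continuous_dotProduct_left x) (continuous_dotProduct_left u)

/-- Every linear functional on `ℝ^d` is given by a vector. -/
theorem exists_dotProduct_eq (l : (Fin d → ℝ) →L[ℝ] ℝ) :
    ∃ h : Fin d → ℝ, ∀ x, l x = dotProduct h x := by
  refine ⟨fun i => l (Pi.single i 1), fun x => ?_⟩
  conv_lhs => rw [pi_eq_sum_univ' x]
  simp [dotProduct, mul_comm]

theorem vertices_convexHull_subset (F : Set (Fin d → ℝ)) : vertices (convexHull ℝ F) ⊆ F :=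
  extremePoints_convexHull_subset

/-- An extreme point u lies outside the convex hull of the other generators, which is closed because
they are finitely many; a separating functional then has u as its unique maximizer. -/
theorem normalCone_nonempty {F : Set (Fin d → ℝ)} (hF : F.Finite) {u : Fin d → ℝ}
    (hu : u ∈ vertices (convexHull ℝ F)) : (normalCone (convexHull ℝ F) u).Nonempty := by
  have hconv := ((convex_convexHull ℝ F).mem_extremePoints_iff_convex_sdiff.1 hu).2
  have hsub : convexHull ℝ (F \ {u}) ⊆ convexHull ℝ F \ {u} :=
    convexHull_min (Set.sdiff_subset_sdiff_left (subset_convexHull ℝ F)) hconv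
  have hcl : IsClosed (convexHull ℝ (F \ {u})) :=
    (hF.subset Set.sdiff_subset).isClosed_convexHull ℝ
  obtain ⟨l, t, h1, h2⟩ := geometric_hahn_banach_closed_point (convex_convexHull ℝ (F \ {u})) hcl
    (fun h => (hsub h).2 rfl : u ∉ convexHull ℝ (F \ {u}))
  obtain ⟨h, hh⟩ := exists_dotProduct_eq l
  refine ⟨h, mem_normalCone_convexHull fun x hx hne => ?_⟩
  rw [← hh, ← hh]
  exact (h1 x (subset_convexHull ℝ _ ⟨hx, hne⟩)).trans h2

theorem mem_vertices_of_mem_normalCone {P : Set (Fin d → ℝ)} {u h : Fin d → ℝ} (hu : u ∈ P)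
    (hh : h ∈ normalCone P u) : u ∈ vertices P := by
  refine ⟨hu, ?_⟩
  rintro x hx y hy ⟨a, b, ha, hb, hab, rfl⟩
  by_contra hne
  set z := a • x + b • y with hz
  have e : dotProduct h z = a * dotProduct h x + b * dotProduct h y := by
    simp [hz, dotProduct_add, dotProduct_smul]
  have hx' : dotProduct h x < dotProduct h z := hh x hx hne
  have hy' : dotProduct h y ≤ dotProduct h z := by
    by_cases h' : y = z
    · exact le_of_eq (by rw [h'])
    · exact (hh y hy h').le
  have e2 : dotProduct h z = a * dotProduct h z + b * dotProduct h z := by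
    rw [← add_mul, hab, one_mul]
  linarith [mul_lt_mul_of_pos_left hx' ha, mul_le_mul_of_nonneg_left hy' hb.le]

theorem normalCone_inter_unique {P : Set (Fin d → ℝ)} {u u' h : Fin d → ℝ} (hu : u ∈ P)
    (hu' : u' ∈ P) (h1 : h ∈ normalCone P u) (h2 : h ∈ normalCone P u') : u = u' := by
  by_contra hne
  exact lt_asymm (h1 u' hu' (Ne.symm hne)) (h2 u hu hne)

/-- Vectors orthogonal to none of finitely many nonzero vectors are dense. -/
theorem exists_mem_forall_dotProduct_ne_zero {ι : Type*} (s : Finset ι) (g : ι → Fin d → ℝ)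
    (hg : ∀ i ∈ s, g i ≠ 0) {U : Set (Fin d → ℝ)} (hU : IsOpen U) (hne : U.Nonempty) :
    ∃ h ∈ U, ∀ i ∈ s, dotProduct h (g i) ≠ 0 := by
  classical
  induction s using Finset.induction_on generalizing U with
  | empty => obtain ⟨h, hh⟩ := hne; exact ⟨h, hh, by simp⟩
  | insert a s has ih =>
    have hopen : IsOpen (U ∩ {h | dotProduct h (g a) ≠ 0}) :=
      hU.inter (isOpen_ne_fun (continuous_dotProduct_left _) continuous_const)
    have hn : (U ∩ {h | dotProduct h (g a) ≠ 0}).Nonempty := by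
      obtain ⟨h, hh⟩ := hne
      by_cases h0 : dotProduct h (g a) = 0
      · have hc : Continuous fun t : ℝ => h + t • g a := by fun_prop
        have hev : ∀ᶠ t in nhds (0 : ℝ), h + t • g a ∈ U :=
          hc.continuousAt.eventually (by simpa using hU.mem_nhds hh)
        obtain ⟨ε, hε, hb⟩ := Metric.eventually_nhds_iff.1 hev
        -- Moving h a little in the direction `g a` stays in U and makes the product with `g a`
        -- positive.
        refine ⟨h + (ε / 2) • g a, hb (by simp [abs_of_pos hε, hε]), ?_⟩
        have hga : dotProduct (g a) (g a) ≠ 0 := by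
          simpa [dotProduct_self_eq_zero] using hg a (by simp)
        simp only [Set.mem_ofPred_eq, add_dotProduct, smul_dotProduct, h0, smul_eq_mul, zero_add]
        exact mul_ne_zero (by positivity) hga
      · exact ⟨h, hh, h0⟩
    obtain ⟨h, ⟨hh, hha⟩, hs⟩ := ih (fun i hi => hg i (by simp [hi])) hopen hn
    refine ⟨h, hh, fun i hi => ?_⟩
    rcases Finset.mem_insert.1 hi with rfl | hi
    · exact hha
    · exact hs i hi

/-- A maximizer common to an open set of functionals is the unique maximizer of each of them. -/
theorem subset_normalCone_of_isOpen {P U : Set (Fin d → ℝ)} (hU : IsOpen U) {u : Fin d → ℝ}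
    (h : ∀ c ∈ U, ∀ x ∈ P, dotProduct c x ≤ dotProduct c u) : U ⊆ normalCone P u := by
  intro c hc x hx hne
  refine lt_of_le_of_ne (h c hc x hx) fun heq => hne ?_
  -- If x tied with u at c, then tilting c towards x - u, still inside U, would make x strictly
  -- better unless x = u.
  have hcont : Continuous fun t : ℝ => c + t • (x - u) := by fun_prop
  have hev : ∀ᶠ t in nhds (0 : ℝ), c + t • (x - u) ∈ U :=
    hcont.continuousAt.eventually (by simpa using hU.mem_nhds hc)
  obtain ⟨ε, hε, hb⟩ := Metric.eventually_nhds_iff.1 hev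
  have h1 := h _ (hb (by simp [abs_of_pos hε, hε] : dist (ε / 2) 0 < ε)) x hx
  simp only [add_dotProduct, smul_dotProduct, smul_eq_mul, heq] at h1
  have h2 : ε / 2 * dotProduct (x - u) (x - u) ≤ 0 := by
    rw [dotProduct_sub (x - u)]; linarith
  have h3 : 0 ≤ dotProduct (x - u) (x - u) := by
    unfold dotProduct; exact Finset.sum_nonneg fun i _ => mul_self_nonneg _
  have h4 : dotProduct (x - u) (x - u) = 0 := by nlinarith
  exact sub_eq_zero.1 (dotProduct_self_eq_zero.1 h4)

/-- A convex function on a polytope is maximized at a vertex. -/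
theorem exists_vertex_ge {F : Set (Fin d → ℝ)} (hF : F.Finite) {f : (Fin d → ℝ) → ℝ}
    (hf : ConvexOn ℝ Set.univ f) {x : Fin d → ℝ} (hx : x ∈ convexHull ℝ F) :
    ∃ u ∈ vertices (convexHull ℝ F), f x ≤ f u := by
  have hfin : (vertices (convexHull ℝ F)).Finite := hF.subset (vertices_convexHull_subset F)
  -- Krein–Milman; with finitely many extreme points no closure is needed.
  have hkm : convexHull ℝ (vertices (convexHull ℝ F)) = convexHull ℝ F := by
    rw [← (hfin.isClosed_convexHull ℝ).closure_eq]
    exact closure_convexHull_extremePoints (hF.isCompact_convexHull ℝ) (convex_convexHull ℝ F)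
  rw [← hkm] at hx
  obtain ⟨u, hu, h⟩ := hf.exists_ge_of_mem_convexHull (Set.subset_univ _) hx
  exact ⟨u, hu, h⟩

theorem vertices_nonempty {F : Set (Fin d → ℝ)} (hF : F.Finite) (hne : F.Nonempty) :
    (vertices (convexHull ℝ F)).Nonempty := by
  obtain ⟨x, hx⟩ := hne
  obtain ⟨u, hu, _⟩ := exists_vertex_ge hF (convexOn_const (0 : ℝ) convex_univ)
    (subset_convexHull ℝ F hx)
  exact ⟨u, hu⟩

theorem vertices_translate (t : Fin d → ℝ) (P : Set (Fin d → ℝ)) :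
    vertices ((fun x => t + x) '' P) = (fun x => t + x) '' vertices P := by
  have key : ∀ (t : Fin d → ℝ) (P : Set (Fin d → ℝ)),
      (fun x => t + x) '' vertices P ⊆ vertices ((fun x => t + x) '' P) := by
    rintro t P _ ⟨u, ⟨hu, h⟩, rfl⟩
    refine ⟨⟨u, hu, rfl⟩, ?_⟩
    rintro _ ⟨x, hx, rfl⟩ _ ⟨y, hy, rfl⟩ ⟨a, b, ha, hb, hab, he⟩
    have : a • x + b • y = u := by
      have e : a • (t + x) + b • (t + y) = t + (a • x + b • y) := by
        rw [smul_add, smul_add, add_add_add_comm, ← add_smul, hab, one_smul]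
      exact add_left_cancel (e.symm.trans he)
    simp only [h hx hy ⟨a, b, ha, hb, hab, this⟩]
  refine Set.Subset.antisymm ?_ (key t P)
  intro v hv
  have := key (-t) _ ⟨v, hv, rfl⟩
  rw [Set.image_image] at this
  simp only [neg_add_cancel_left, Set.image_id'] at this
  exact ⟨_, this, by simp⟩

end Polytope

/-! ### The greedy algorithm for matroids -/

section Greedy

variable {n : ℕ} {R : Type*} [CommRing R] {α : Type*} [LinearOrder α]

/-- The indicator vector of a set. -/
noncomputable def charVec (B : Set (Fin n)) : Fin n → ℤ := B.indicator fun _ => (1 : ℤ)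

theorem charVec_le_iff {A B : Set (Fin n)} : charVec A ≤ charVec B ↔ A ⊆ B := by
  constructor
  · intro h j hj
    by_contra hB
    have := h j
    simp [charVec, hj, hB] at this
  · intro h
    exact Set.indicator_le_indicator_of_subset h (fun _ => zero_le_one)

theorem charVec_insert {A : Set (Fin n)} {j : Fin n} (hj : j ∉ A) :
    charVec A + Pi.single j 1 = charVec (insert j A) := by
  ext i
  by_cases hij : i = j
  · subst hij; simp [charVec, hj]
  · by_cases hi : i ∈ A
    · simp [charVec, hij, hi]
    · have : i ∉ insert j A := by simp [hij, hi]
      simp [charVec, hij, hi, this]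

/-- The utility of an integer vector, for utilities in an ordered ring. -/
def utility (w : Fin n → R) (x : Fin n → ℤ) : R := ∑ j, w j * (x j : R)

theorem utility_int (w x : Fin n → ℤ) : utility w x = dotProduct w x := by
  simp [utility, dotProduct]

theorem utility_charVec_insert (w : Fin n → R) {B : Set (Fin n)} {j : Fin n} (hj : j ∉ B) :
    utility w (charVec (insert j B)) = utility w (charVec B) + w j := by
  rw [← charVec_insert hj]
  simp [utility, mul_add, Finset.sum_add_distrib, Pi.single_apply]

theorem IsMatroid.finite {S : Set (Fin n → ℤ)} (hS : IsMatroid S) : S.Finite := by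
  obtain ⟨M, hE, rfl⟩ := hS
  refine (Set.finite_range (charVec : Set (Fin n) → Fin n → ℤ)).subset ?_
  rintro _ ⟨B, _, rfl⟩
  exact ⟨B, rfl⟩

theorem IsMatroid.nonempty {S : Set (Fin n → ℤ)} (hS : IsMatroid S) : S.Nonempty := by
  obtain ⟨M, hE, rfl⟩ := hS
  obtain ⟨B, hB⟩ := M.exists_isBase
  exact ⟨_, B, hB, rfl⟩

theorem indep_charVec_iff {S : Set (Fin n → ℤ)} (M : Matroid (Fin n))
    (hS : S = {x | ∃ B : Set (Fin n), M.IsBase B ∧ x = B.indicator fun _ => (1 : ℤ)})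
    (A : Set (Fin n)) : Indep S (charVec A) ↔ M.Indep A := by
  subst hS
  constructor
  · rintro ⟨_, ⟨B, hB, rfl⟩, hle⟩
    exact hB.indep.subset (charVec_le_iff.1 hle)
  · intro hA
    obtain ⟨B, hB, hAB⟩ := hA.exists_isBase_superset
    exact ⟨_, ⟨B, hB, rfl⟩, charVec_le_iff.2 hAB⟩

/-- Exchange step: an independent `insert j I` is contained in a base that differs from a given
base `B ⊇ I` by the exchange of one element outside `I` for `j`. -/
theorem Matroid.IsBase.exists_exchange {M : Matroid (Fin n)}
    {B I : Set (Fin n)} {j : Fin n}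
    (hB : M.IsBase B) (hIB : I ⊆ B) (hjB : j ∉ B) (hI : M.Indep (insert j I)) :
    ∃ e ∈ B, e ∉ I ∧ M.IsBase (insert j (B \ {e})) := by
  -- Extend `insert j I` to a base inside its union with B. This base lies in `insert j B` and has
  -- the size of B, so it misses exactly one element of B, and that element is not in I.
  obtain ⟨B', hB', h1, h2⟩ := hI.exists_isBase_subset_union_isBase hB
  have h2' : B' ⊆ insert j B := by
    intro x hx
    rcases h2 hx with h | h
    · rcases h with rfl | h
      · exact Or.inl rfl
      · exact Or.inr (hIB h)
    · exact Or.inr h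
  have hcard : B'.ncard = B.ncard := hB'.ncard_eq_ncard_of_isBase hB
  have hj' : j ∈ B' := h1 (Set.mem_insert _ _)
  have hBB' : ¬ B ⊆ B' := by
    intro h
    exact hjB ((Set.eq_of_subset_of_ncard_le h hcard.le (Set.toFinite _)) ▸ hj')
  obtain ⟨e, heB, heB'⟩ := Set.not_subset.1 hBB'
  refine ⟨e, heB, fun h => heB' (h1 (Set.mem_insert_of_mem _ h)), ?_⟩
  have hsub : B' ⊆ insert j (B \ {e}) := by
    intro x hx
    rcases h2' hx with h | h
    · exact Or.inl h
    · exact Or.inr ⟨h, fun hxe => heB' (by rw [← Set.mem_singleton_iff.1 hxe]; exact hx)⟩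
  have : B' = insert j (B \ {e}) := by
    refine Set.eq_of_subset_of_ncard_le hsub ?_ (Set.toFinite _)
    rw [Set.ncard_insert_of_notMem (fun h => hjB h.1) (Set.toFinite _),
      Set.ncard_sdiff_singleton_add_one heB (Set.toFinite _), hcard]
  exact this ▸ hB'

open Classical in
/-- The step of the greedy algorithm. -/
noncomputable def greedyStep (S : Set (Fin n → ℤ)) (y : Fin n → ℤ) (j : Fin n) : Fin n → ℤ :=
  if Indep S (y + Pi.single j 1) then y + Pi.single j 1 else y

theorem greedyAlong_eq (S : Set (Fin n → ℤ)) (L : List (Fin n)) :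
    greedyAlong S L = L.foldl (greedyStep S) 0 := rfl

/-- The exchange argument, as an invariant: the set I chosen so far lies in a base B whose remaining
elements are still to come. When greedy takes some j outside B, the exchanged element e comes later
in the list, so it is worth at most `w j` and the swap loses nothing. At the end I is all of B. The
ring is arbitrary because real utilities serve the geometry and integer ones the algorithm. -/
theorem foldl_greedyStep_charVec [LinearOrder R] [IsStrictOrderedRing R]
    {S : Set (Fin n → ℤ)} (M : Matroid (Fin n))
    (hS : S = {x | ∃ B : Set (Fin n), M.IsBase B ∧ x = B.indicator fun _ => (1 : ℤ)})
    {w : Fin n → R} (L : List (Fin n)) (hL : L.Pairwise fun i j => w j ≤ w i) (hnd : L.Nodup)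
    {B I : Set (Fin n)} (hB : M.IsBase B) (hIB : I ⊆ B) (hI : ∀ j, j ∉ I → j ∈ B → j ∈ L)
    (hIL : ∀ j ∈ I, j ∉ L) :
    ∃ B', M.IsBase B' ∧ L.foldl (greedyStep S) (charVec I) = charVec B' ∧
      utility w (charVec B) ≤ utility w (charVec B') := by
  induction L generalizing B I with
  | nil =>
    refine ⟨B, hB, ?_, le_rfl⟩
    have : I = B := Set.Subset.antisymm hIB fun j hj => by
      by_contra h; simpa using hI j h hj
    simp [this]
  | cons j L ih =>
    have hjI : j ∉ I := fun h => hIL j h (by simp)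
    rw [List.pairwise_cons] at hL
    rw [List.nodup_cons] at hnd
    rw [List.foldl_cons, greedyStep, charVec_insert hjI, indep_charVec_iff M hS]
    split_ifs with hind
    · have hIL' : ∀ i ∈ insert j I, i ∉ L := by
        rintro i (rfl | hi)
        · exact hnd.1
        · exact fun h => hIL i hi (by simp [h])
      by_cases hjB : j ∈ B
      · refine ih hL.2 hnd.2 hB (Set.insert_subset hjB hIB) ?_ hIL'
        intro i hi hiB
        have := hI i (fun h => hi (Or.inr h)) hiB
        rcases List.mem_cons.1 this with rfl | h
        · exact absurd (Or.inl rfl) hi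
        · exact h
      · obtain ⟨e, heB, heI, hB'⟩ := hB.exists_exchange hIB hjB hind
        have hej : e ≠ j := fun h => hjB (h ▸ heB)
        have heL : e ∈ L := (List.mem_cons.1 (hI e heI heB)).resolve_left hej
        obtain ⟨B'', h1, h2, h3⟩ := ih hL.2 hnd.2 hB'
          (Set.insert_subset_insert fun i hi => ⟨hIB hi, fun h => heI (by
            rw [← Set.mem_singleton_iff.1 h]; exact hi)⟩)
          (by
            rintro i hi (rfl | hiB)
            · exact absurd (Or.inl rfl) hi
            · rcases List.mem_cons.1 (hI i (fun h => hi (Or.inr h)) hiB.1) with rfl | h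
              · exact absurd (Or.inl rfl) hi
              · exact h) hIL'
        refine ⟨B'', h1, h2, le_trans ?_ h3⟩
        rw [utility_charVec_insert w (fun h => hjB h.1)]
        have : B = insert e (B \ {e}) := by simp [Set.insert_eq_of_mem heB]
        rw [this, utility_charVec_insert w (by simp)]
        simp only [Set.insert_sdiff_singleton, Set.insert_eq_of_mem heB]
        linarith [hL.1 e heL]
    · refine ih hL.2 hnd.2 hB hIB ?_ fun i hi h => hIL i hi (by simp [h])
      intro i hi hiB
      rcases List.mem_cons.1 (hI i hi hiB) with rfl | h
      · exact absurd (hB.indep.subset (Set.insert_subset hiB hIB)) hind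
      · exact h

/-- The greedy algorithm along an order of nonincreasing utility finds an optimal basis. -/
theorem greedyAlong_optimal [LinearOrder R] [IsStrictOrderedRing R]
    {S : Set (Fin n → ℤ)} (hS : IsMatroid S) {w : Fin n → R}
    {L : List (Fin n)} (hnd : L.Nodup) (hall : ∀ j, j ∈ L) (hL : L.Pairwise fun i j => w j ≤ w i) :
    greedyAlong S L ∈ S ∧ ∀ y ∈ S, utility w y ≤ utility w (greedyAlong S L) := by
  obtain ⟨M, hE, hS⟩ := hS
  have h0 : (0 : Fin n → ℤ) = charVec ∅ := by ext; simp [charVec]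
  have key : ∀ B, M.IsBase B → ∃ B', M.IsBase B' ∧ greedyAlong S L = charVec B' ∧
      utility w (charVec B) ≤ utility w (charVec B') := fun B hB => by
    rw [greedyAlong_eq, h0]
    exact foldl_greedyStep_charVec M hS L hL hnd hB (Set.empty_subset _) (fun j _ _ => hall j)
      (by simp)
  obtain ⟨B, hB⟩ := M.exists_isBase
  obtain ⟨B', hB', he, _⟩ := key B hB
  constructor
  · rw [he, hS]; exact ⟨B', hB', rfl⟩
  · intro y hy
    rw [hS] at hy
    obtain ⟨B₁, hB₁, rfl⟩ := hy
    obtain ⟨B₂, _, he₂, hle⟩ := key B₁ hB₁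
    rw [he₂]; exact hle

theorem IsGreedySolution.solvesLinear {S : Set (Fin n → ℤ)} (hS : IsMatroid S) {w x : Fin n → ℤ}
    (hx : IsGreedySolution S w x) : SolvesLinear S w x := by
  obtain ⟨L, hnd, hall, hL, rfl⟩ := hx
  obtain ⟨h1, h2⟩ := greedyAlong_optimal hS hnd hall hL
  exact ⟨h1, fun y hy => by simpa only [utility_int] using h2 y hy⟩

/-- The number of elements of utility greater than that of `j`. -/
def utilityRank (w : Fin n → α) (j : Fin n) : ℕ := (Finset.univ.filter fun i => w j < w i).card

theorem utilityRank_lt (w : Fin n → α) (j : Fin n) : utilityRank w j < n := by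
  have : (Finset.univ.filter fun i => w j < w i) ⊂ Finset.univ := by
    refine Finset.filter_ssubset.2 ⟨j, by simp, by simp⟩
  simpa [utilityRank] using Finset.card_lt_card this

theorem utilityRank_lt_of_lt {w : Fin n → α} {i j : Fin n} (h : w i < w j) :
    utilityRank w j < utilityRank w i := by
  refine Finset.card_lt_card ?_
  rw [Finset.ssubset_iff_of_subset]
  · exact ⟨j, by simpa using h, by simp⟩
  · intro k hk
    simp only [Finset.mem_filter, Finset.mem_univ, true_and] at hk ⊢
    exact h.trans hk

/-- The elements of the ground set in an order of nonincreasing utility. -/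
def greedyOrder (w : Fin n → α) : List (Fin n) :=
  (List.range n).flatMap fun k => (List.finRange n).filter fun j => utilityRank w j = k

/-- Elements of different utility have different ranks, the better one the smaller. So listing by
increasing rank sorts by nonincreasing utility, and n sweeps through the ground set replace a
sorting routine. -/
theorem greedyOrder_spec (w : Fin n → α) :
    (greedyOrder w).Nodup ∧ (∀ j, j ∈ greedyOrder w) ∧
      (greedyOrder w).Pairwise fun i j => w j ≤ w i := by
  refine ⟨?_, ?_, ?_⟩
  · refine List.nodup_flatMap.2 ⟨fun k _ => (List.nodup_finRange n).filter _, ?_⟩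
    refine List.Pairwise.imp ?_ (List.nodup_range (n := n))
    intro a b hab
    simp only [Function.onFun, List.disjoint_left, List.mem_filter, List.mem_finRange, true_and,
      decide_eq_true_eq]
    rintro j rfl h
    exact hab h
  · intro j
    simp [greedyOrder, utilityRank_lt]
  · refine List.pairwise_flatMap.2 ⟨?_, ?_⟩
    · intro k _
      refine List.Pairwise.imp_of_mem ?_ ((List.nodup_finRange n).filter _)
      intro a b ha hb _
      simp only [List.mem_filter, List.mem_finRange, true_and, decide_eq_true_eq] at ha hb
      by_contra h
      have := utilityRank_lt_of_lt (not_le.1 h)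
      omega
    · refine List.Pairwise.imp ?_ (List.pairwise_lt_range (n := n))
      intro k l hkl a ha b hb
      simp only [List.mem_filter, List.mem_finRange, true_and, decide_eq_true_eq] at ha hb
      by_contra h
      have := utilityRank_lt_of_lt (not_le.1 h)
      omega

theorem isGreedySolution_greedyOrder (S : Set (Fin n → ℤ)) (w : Fin n → ℤ) :
    IsGreedySolution S w (greedyAlong S (greedyOrder w)) :=
  ⟨greedyOrder w, (greedyOrder_spec w).1, (greedyOrder_spec w).2.1, (greedyOrder_spec w).2.2, rfl⟩

end Greedy

/-! ### Zonotopes -/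

section Zonotope

variable {d : ℕ}

open scoped Pointwise in
/-- The Minkowski sum of the segments from `0` to the vectors of `s`. -/
def zonotope (s : Finset (Fin d → ℤ)) : Set (Fin d → ℝ) := ∑ g ∈ s, segment ℝ 0 (realVec g)

/-- `h` is orthogonal to no vector of `s`. -/
def IsGeneric (s : Finset (Fin d → ℤ)) (h : Fin d → ℝ) : Prop :=
  ∀ g ∈ s, dotProduct h (realVec g) ≠ 0

open Classical in
/-- The vertex of the zonotope of `s` at which a generic `h` is maximized. -/
noncomputable def zonotopeVertex (s : Finset (Fin d → ℤ)) (h : Fin d → ℝ) : Fin d → ℝ :=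
  ∑ g ∈ s.filter fun g => 0 < dotProduct h (realVec g), realVec g

-- Convex hulls commute with Minkowski sums. This presents the zonotope as the hull of a finite set,
-- to which the results on polytopes apply.
open scoped Pointwise in
theorem zonotope_eq_convexHull (s : Finset (Fin d → ℤ)) :
    zonotope s = convexHull ℝ (∑ g ∈ s, ({0, realVec g} : Set (Fin d → ℝ))) := by
  simp only [convexHull_sum, convexHull_pair, zonotope]

open scoped Pointwise in
theorem finite_zonotope_generators (s : Finset (Fin d → ℤ)) :
    (∑ g ∈ s, ({0, realVec g} : Set (Fin d → ℝ))).Finite := by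
  classical
  induction s using Finset.induction_on with
  | empty => simp
  | insert a s ha ih => rw [Finset.sum_insert ha]; exact (Set.toFinite _).add ih

theorem mem_zonotope_iff (s : Finset (Fin d → ℤ)) (x : Fin d → ℝ) :
    x ∈ zonotope s ↔ ∃ c : (Fin d → ℤ) → ℝ, (∀ g ∈ s, 0 ≤ c g ∧ c g ≤ 1) ∧
      x = ∑ g ∈ s, c g • realVec g := by
  unfold zonotope
  rw [Set.mem_finsetSum]
  constructor
  · rintro ⟨f, hf, rfl⟩
    have : ∀ g, ∃ c : ℝ, g ∈ s → (0 ≤ c ∧ c ≤ 1) ∧ f g = c • realVec g := by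
      intro g
      by_cases hg : g ∈ s
      · obtain ⟨a, b, ha, hb, hab, he⟩ := hf hg
        exact ⟨b, fun _ => ⟨⟨hb, by linarith⟩, by simp [← he]⟩⟩
      · exact ⟨0, fun h => absurd h hg⟩
    choose c hc using this
    exact ⟨c, fun g hg => (hc g hg).1, Finset.sum_congr rfl fun g hg => (hc g hg).2⟩
  · rintro ⟨c, hc, rfl⟩
    refine ⟨fun g => c g • realVec g, fun {g} hg => ?_, rfl⟩
    exact ⟨1 - c g, c g, by linarith [(hc g hg).2], (hc g hg).1, by ring, by simp⟩

theorem sum_mem_zonotope {s T : Finset (Fin d → ℤ)} (hT : T ⊆ s) :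
    ∑ g ∈ T, realVec g ∈ zonotope s := by
  classical
  rw [mem_zonotope_iff]
  refine ⟨fun g => if g ∈ T then 1 else 0, fun g _ => by dsimp only; split_ifs <;> simp, ?_⟩
  simp only [ite_smul, one_smul, zero_smul]
  rw [← Finset.sum_filter, Finset.filter_mem_eq_inter, Finset.inter_eq_right.2 hT]

theorem zonotopeVertex_mem (s : Finset (Fin d → ℤ)) (h : Fin d → ℝ) :
    zonotopeVertex s h ∈ zonotope s := sum_mem_zonotope (Finset.filter_subset _ _)

/-- The support function of the zonotope: each segment contributes its better endpoint, whether or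
not h is generic. -/
theorem dotProduct_zonotopeVertex (s : Finset (Fin d → ℤ)) (h : Fin d → ℝ) :
    dotProduct h (zonotopeVertex s h) = ∑ g ∈ s, max 0 (dotProduct h (realVec g)) := by
  classical
  rw [zonotopeVertex, dotProduct_sum, Finset.sum_filter]
  refine Finset.sum_congr rfl fun g _ => ?_
  split_ifs with h'
  · exact (max_eq_right h'.le).symm
  · exact (max_eq_left (not_lt.1 h')).symm

theorem mul_le_max_zero {c a : ℝ} (h0 : 0 ≤ c) (h1 : c ≤ 1) : c * a ≤ max 0 a := by
  rcases le_total a 0 with h | h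
  · rw [max_eq_left h]; exact mul_nonpos_of_nonneg_of_nonpos h0 h
  · rw [max_eq_right h]; nlinarith

theorem dotProduct_le_of_mem_zonotope {s : Finset (Fin d → ℤ)} {x : Fin d → ℝ}
    (hx : x ∈ zonotope s) (h : Fin d → ℝ) :
    dotProduct h x ≤ dotProduct h (zonotopeVertex s h) := by
  obtain ⟨c, hc, rfl⟩ := (mem_zonotope_iff s x).1 hx
  rw [dotProduct_zonotopeVertex, dotProduct_sum]
  refine Finset.sum_le_sum fun g hg => ?_
  rw [dotProduct_smul, smul_eq_mul]
  exact mul_le_max_zero (hc g hg).1 (hc g hg).2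

/-- Equality with the support function forces equality in every summand, and as no product of h with
a generator vanishes, this determines every coefficient. -/
theorem IsGeneric.mem_normalCone {s : Finset (Fin d → ℤ)} {h : Fin d → ℝ} (hh : IsGeneric s h) :
    h ∈ normalCone (zonotope s) (zonotopeVertex s h) := by
  classical
  intro x hx hne
  refine lt_of_le_of_ne (dotProduct_le_of_mem_zonotope hx h) fun heq => hne ?_
  obtain ⟨c, hc, rfl⟩ := (mem_zonotope_iff s x).1 hx
  rw [dotProduct_zonotopeVertex, dotProduct_sum] at heq
  have hle : ∀ g ∈ s, dotProduct h (c g • realVec g) ≤ max 0 (dotProduct h (realVec g)) := by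
    intro g hg
    rw [dotProduct_smul, smul_eq_mul]
    exact mul_le_max_zero (hc g hg).1 (hc g hg).2
  have hterm := (Finset.sum_eq_sum_iff_of_le hle).1 heq
  rw [zonotopeVertex, Finset.sum_filter]
  refine Finset.sum_congr rfl fun g hg => ?_
  have h1 := hterm g hg
  rw [dotProduct_smul, smul_eq_mul] at h1
  split_ifs with h'
  · rw [max_eq_right h'.le] at h1
    have : c g = 1 := mul_right_cancel₀ h'.ne' (by linarith)
    rw [this, one_smul]
  · rw [max_eq_left (not_lt.1 h')] at h1
    have : c g = 0 := (mul_eq_zero.1 h1).resolve_right (hh g hg)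
    rw [this, zero_smul]

theorem IsGeneric.mem_vertices {s : Finset (Fin d → ℤ)} {h : Fin d → ℝ} (hh : IsGeneric s h) :
    zonotopeVertex s h ∈ vertices (zonotope s) :=
  mem_vertices_of_mem_normalCone (zonotopeVertex_mem s h) hh.mem_normalCone

/-- If h were orthogonal to a generator g, then v + g would be a second maximizer. So the normal
cones at vertices consist of generic vectors only. -/
theorem isGeneric_of_mem_normalCone {s : Finset (Fin d → ℤ)} (hs : ∀ g ∈ s, g ≠ 0)
    {h v : Fin d → ℝ} (hv : v ∈ zonotope s) (hh : h ∈ normalCone (zonotope s) v) :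
    IsGeneric s h ∧ v = zonotopeVertex s h := by
  classical
  have hv' : v = zonotopeVertex s h := by
    by_contra hne
    exact absurd (hh _ (zonotopeVertex_mem s h) (Ne.symm hne))
      (not_lt.2 (dotProduct_le_of_mem_zonotope hv h))
  refine ⟨fun g hg h0 => ?_, hv'⟩
  have hgm : g ∉ s.filter fun g => 0 < dotProduct h (realVec g) := by simp [h0]
  have e : ∑ g' ∈ insert g (s.filter fun g => 0 < dotProduct h (realVec g)), realVec g' =
      realVec g + v := by
    rw [Finset.sum_insert hgm, hv', zonotopeVertex]
  have hmem : realVec g + v ∈ zonotope s := by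
    rw [← e]
    exact sum_mem_zonotope (Finset.insert_subset hg (Finset.filter_subset _ _))
  have := hh _ hmem (by simpa [realVec_eq_zero] using hs g hg)
  rw [dotProduct_add, h0, zero_add] at this
  exact lt_irrefl _ this

theorem exists_generic_of_mem_vertices {s : Finset (Fin d → ℤ)} (hs : ∀ g ∈ s, g ≠ 0)
    {v : Fin d → ℝ} (hv : v ∈ vertices (zonotope s)) :
    ∃ h, IsGeneric s h ∧ v = zonotopeVertex s h := by
  have hv' := hv
  rw [zonotope_eq_convexHull] at hv'
  obtain ⟨h, hh⟩ := normalCone_nonempty (finite_zonotope_generators s) hv'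
  rw [← zonotope_eq_convexHull] at hh
  exact ⟨h, isGeneric_of_mem_normalCone hs hv.1 hh⟩

theorem finite_vertices_zonotope (s : Finset (Fin d → ℤ)) : (vertices (zonotope s)).Finite := by
  rw [zonotope_eq_convexHull]
  exact (finite_zonotope_generators s).subset (vertices_convexHull_subset _)

theorem isOpen_normalCone_zonotope (s : Finset (Fin d → ℤ)) (v : Fin d → ℝ) :
    IsOpen (normalCone (zonotope s) v) := by
  rw [zonotope_eq_convexHull]
  exact isOpen_normalCone_convexHull (finite_zonotope_generators s) v

/-- Generic vectors select the same vertex of a zonotope if and only if their scalar products with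
the generators have the same signs. -/
theorem zonotopeVertex_eq_iff {s : Finset (Fin d → ℤ)} {h h' : Fin d → ℝ} (hh : IsGeneric s h) :
    zonotopeVertex s h = zonotopeVertex s h' ↔
      ∀ g ∈ s, 0 < dotProduct h (realVec g) ↔ 0 < dotProduct h' (realVec g) := by
  classical
  constructor
  · intro heq
    -- The vertex selected by h' attains the support function at h, so the comparison can be made
    -- generator by generator.
    have h1 : dotProduct h (zonotopeVertex s h') = ∑ g ∈ s, max 0 (dotProduct h (realVec g)) := by
      rw [← heq, dotProduct_zonotopeVertex]
    rw [zonotopeVertex, dotProduct_sum, Finset.sum_filter] at h1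
    have hle : ∀ g ∈ s, (if 0 < dotProduct h' (realVec g) then dotProduct h (realVec g) else 0) ≤
        max 0 (dotProduct h (realVec g)) := by
      intro g _
      split_ifs
      · exact le_max_right _ _
      · exact le_max_left _ _
    intro g hg
    have h2 := (Finset.sum_eq_sum_iff_of_le hle).1 h1 g hg
    have hne := hh g hg
    split_ifs at h2 with h3
    · refine iff_of_true ?_ h3
      rcases hne.lt_or_gt with h4 | h4
      · rw [max_eq_left h4.le] at h2; exact absurd h2 hne
      · exact h4
    · refine iff_of_false (fun h4 => ?_) h3
      rw [max_eq_right h4.le] at h2; exact hne h2.symm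
  · intro heq
    rw [zonotopeVertex, zonotopeVertex, Finset.filter_congr heq]

end Zonotope

/-! ### The primitive zonotope -/

section Primitive

variable {d : ℕ}

theorem primitiveZonotope_eq (d p : ℕ) :
    primitiveZonotope d p = zonotope (primitiveGenerators d p) := rfl

theorem mem_primitiveGenerators {p : ℕ} {v : Fin d → ℤ} :
    v ∈ primitiveGenerators d p ↔ (∀ i, |v i| ≤ p) ∧ Finset.univ.gcd v = 1 ∧
      ∃ i, 0 < v i ∧ ∀ j < i, v j = 0 := by
  unfold primitiveGenerators
  rw [Finset.mem_filter, Finset.mem_Icc]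
  refine and_congr_left fun _ => ?_
  simp only [Pi.le_def, abs_le]
  exact ⟨fun h i => ⟨h.1 i, h.2 i⟩, fun h => ⟨fun i => (h i).1, fun i => (h i).2⟩⟩

theorem ne_zero_of_mem_primitiveGenerators {p : ℕ} {v : Fin d → ℤ}
    (hv : v ∈ primitiveGenerators d p) : v ≠ 0 := by
  obtain ⟨_, _, i, hi, _⟩ := mem_primitiveGenerators.1 hv
  rintro rfl
  simp at hi

/-- Divide by the greatest common divisor, which only shrinks the entries, and fix the sign by the
first nonzero entry. Hence the generators account for every hyperplane orthogonal to a nonzero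
integer vector of sup-norm at most p. -/
theorem exists_primitive_multiple {p : ℕ} {v : Fin d → ℤ} (hv : v ≠ 0) (hp : ∀ i, |v i| ≤ p) :
    ∃ g ∈ primitiveGenerators d p, ∃ c : ℤ, c ≠ 0 ∧ v = c • g := by
  obtain ⟨i₀, hi₀⟩ := Function.ne_iff.1 hv
  obtain ⟨g, hg, hg1⟩ := Finset.extract_gcd v (s := Finset.univ) ⟨i₀, Finset.mem_univ _⟩
  set G := Finset.univ.gcd v
  have hG : G ≠ 0 := fun h => hi₀ (by rw [hg i₀ (Finset.mem_univ _), h, zero_mul]; rfl)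
  have hvG : v = G • g := by ext i; simpa using hg i (Finset.mem_univ _)
  have hgp : ∀ i, |g i| ≤ p := by
    intro i
    refine le_trans ?_ (hp i)
    rw [hvG, Pi.smul_apply, smul_eq_mul, abs_mul]
    have := Int.one_le_abs hG
    nlinarith [abs_nonneg (g i)]
  have hex : ∃ i, g i ≠ 0 ∧ ∀ j < i, g j = 0 := by
    have hne : (Finset.univ.filter fun i => g i ≠ 0).Nonempty := by
      refine ⟨i₀, ?_⟩
      simp only [Finset.mem_filter, Finset.mem_univ, true_and]
      intro h; exact hi₀ (by rw [hg i₀ (Finset.mem_univ _), h, mul_zero]; rfl)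
    refine ⟨Finset.min' _ hne, (Finset.mem_filter.1 (Finset.min'_mem _ hne)).2, fun j hj => ?_⟩
    by_contra h
    exact absurd hj (not_lt.2 (Finset.min'_le _ _ (by simpa using h)))
  obtain ⟨i, hi, hlt⟩ := hex
  rcases hi.lt_or_gt with h | h
  · refine ⟨-g, mem_primitiveGenerators.2 ⟨by simpa using hgp, ?_, i, by simpa using h,
      by simpa using hlt⟩, -G, by simpa using hG, by rw [neg_smul_neg, hvG]⟩
    have := Finset.gcd_mul_left (s := Finset.univ) (f := g) (a := (-1 : ℤ))
    rw [hg1] at this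
    have e : (-g) = fun x => -1 * g x := by ext; simp
    rw [e, this]; rfl
  · exact ⟨g, mem_primitiveGenerators.2 ⟨hgp, hg1, i, h, hlt⟩, G, hG, hvG⟩

/-- Two generic vectors with the same vertex of the primitive zonotope have scalar products of the
same sign with every integer vector of sup-norm at most `p`. -/
theorem dotProduct_mul_pos_of_zonotopeVertex_eq {p : ℕ} {h h' : Fin d → ℝ}
    (hh : IsGeneric (primitiveGenerators d p) h) (hh' : IsGeneric (primitiveGenerators d p) h')
    (heq : zonotopeVertex (primitiveGenerators d p) h =
      zonotopeVertex (primitiveGenerators d p) h') {v : Fin d → ℤ} (hp : ∀ i, |v i| ≤ p)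
    (hv : v ≠ 0) :
    0 < dotProduct h (realVec v) * dotProduct h' (realVec v) := by
  obtain ⟨g, hg, c, hc, rfl⟩ := exists_primitive_multiple hv hp
  have e : realVec (c • g) = (c : ℝ) • realVec g := by ext; simp [realVec]
  rw [e, dotProduct_smul, dotProduct_smul, smul_eq_mul, smul_eq_mul]
  have h1 := (zonotopeVertex_eq_iff hh).1 heq g hg
  have h2 : 0 < dotProduct h (realVec g) * dotProduct h' (realVec g) := by
    rcases (hh g hg).lt_or_gt with h3 | h3
    · have h4 := (hh' g hg).lt_or_gt.resolve_right fun h => lt_asymm h3 (h1.2 h)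
      exact mul_pos_of_neg_of_neg h3 h4
    · exact mul_pos h3 (h1.1 h3)
  -- The factor c occurs in both products, so its sign cancels.
  have h3 : (0 : ℝ) < c * c := by
    exact mul_self_pos.2 (by exact_mod_cast hc)
  nlinarith [mul_pos h3 h2]

end Primitive

/-! ### Refinement of projections of matroids -/

section Refinement

variable {d n : ℕ}

theorem IsMatroid.finite_image {S : Set (Fin n → ℤ)} (hS : IsMatroid S)
    (W : Matrix (Fin d) (Fin n) ℤ) : ((fun x => realVec (W.mulVec x)) '' S).Finite :=
  hS.finite.image _

theorem dotProduct_realVec_mulVec (W : Matrix (Fin d) (Fin n) ℤ) (h : Fin d → ℝ)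
    (x : Fin n → ℤ) :
    dotProduct h (realVec (W.mulVec x)) =
      utility (fun j => dotProduct h (realVec fun i => W i j)) x := by
  simp only [dotProduct, realVec, Matrix.mulVec, utility, Int.cast_sum, Int.cast_mul,
    Finset.mul_sum, Finset.sum_mul]
  rw [Finset.sum_comm]
  simp only [mul_assoc]

/-- The normal cone of the primitive zonotope at a vertex is contained in the normal cone of the
projection of a matroid at some vertex. -/
theorem exists_vertex_normalCone_subset {p : ℕ} {S : Set (Fin n → ℤ)} (hS : IsMatroid S)
    {W : Matrix (Fin d) (Fin n) ℤ} (hW : IsBoundedUtility p W) {h : Fin d → ℝ}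
    (hh : IsGeneric (primitiveGenerators d p) h) :
    ∃ u ∈ vertices (projPolytope W S),
      normalCone (primitiveZonotope d p) (zonotopeVertex (primitiveGenerators d p) h) ⊆
        normalCone (projPolytope W S) u := by
  set w : (Fin d → ℝ) → Fin n → ℝ := fun c j => dotProduct c (realVec fun i => W i j) with hw
  obtain ⟨hnd, hall, hL⟩ := greedyOrder_spec (w h)
  set x := greedyAlong S (greedyOrder (w h)) with hx
  have hsub : normalCone (primitiveZonotope d p)
      (zonotopeVertex (primitiveGenerators d p) h) ⊆
        normalCone (projPolytope W S) (realVec (W.mulVec x)) := by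
    -- It suffices that the greedy basis for h is optimal for every c in the cone; openness turns
    -- this into unique maximality of its image.
    refine subset_normalCone_of_isOpen
      (isOpen_normalCone_zonotope (primitiveGenerators d p) _) ?_
    intro c hc
    obtain ⟨hc1, hc2⟩ := isGeneric_of_mem_normalCone
      (fun g hg => ne_zero_of_mem_primitiveGenerators hg) (zonotopeVertex_mem _ h) hc
    -- The greedy order for h is also one for c. Equal columns have equal utilities, and different
    -- columns differ by an integer vector of sup-norm at most p, on which h and c have the same
    -- sign.
    have hL' : (greedyOrder (w h)).Pairwise fun i j => w c j ≤ w c i := by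
      refine hL.imp fun {i j} hij => ?_
      by_cases he : (fun k => W k i - W k j) = 0
      · have : (fun k => W k j) = fun k => W k i := by
          ext k; have := congrFun he k; simp only [Pi.zero_apply] at this; omega
        simp [hw, this]
      · have hb : ∀ k, |W k i - W k j| ≤ p := fun k => by
          have h1 := hW k i
          have h2 := hW k j
          rw [abs_le]; omega
        have h1 := dotProduct_mul_pos_of_zonotopeVertex_eq hh hc1 hc2 hb he
        have h2 : ∀ a : Fin d → ℝ, dotProduct a (realVec fun k => W k i - W k j) =
            w a i - w a j := fun a => by
          rw [hw, ← dotProduct_sub, ← realVec_sub]; rfl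
        rw [h2, h2] at h1
        by_contra h3
        nlinarith [sub_nonneg.2 hij, not_le.1 h3]
    have hopt := (greedyAlong_optimal hS hnd hall hL').2
    have hconv : Convex ℝ {y : Fin d → ℝ | dotProduct c y ≤
        dotProduct c (realVec (W.mulVec x))} := by
      refine convex_halfSpace_le ⟨fun a b => dotProduct_add c a b, fun a b => ?_⟩ _
      rw [dotProduct_smul]
    refine fun y hy => convexHull_min ?_ hconv hy
    rintro _ ⟨z, hz, rfl⟩
    change dotProduct c _ ≤ dotProduct c _
    rw [dotProduct_realVec_mulVec, dotProduct_realVec_mulVec]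
    exact hopt z hz
  have hxS : x ∈ S := (greedyAlong_optimal hS hnd hall hL).1
  exact ⟨_, mem_vertices_of_mem_normalCone (subset_convexHull ℝ _ ⟨x, hxS, rfl⟩)
    (hsub hh.mem_normalCone), hsub⟩

theorem refines_projPolytope {p : ℕ} {S : Set (Fin n → ℤ)} (hS : IsMatroid S)
    {W : Matrix (Fin d) (Fin n) ℤ} (hW : IsBoundedUtility p W) :
    Refines (primitiveZonotope d p) (projPolytope W S) := by
  intro v hv
  obtain ⟨h, hh, rfl⟩ := exists_generic_of_mem_vertices
    (fun g hg => ne_zero_of_mem_primitiveGenerators hg) hv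
  exact exists_vertex_normalCone_subset hS hW hh

/-- At every vertex of the projection some generic vector is maximized. -/
theorem exists_generic_mem_normalCone (p : ℕ) {S : Set (Fin n → ℤ)} (hS : IsMatroid S)
    (W : Matrix (Fin d) (Fin n) ℤ) {u : Fin d → ℝ} (hu : u ∈ vertices (projPolytope W S)) :
    ∃ h, IsGeneric (primitiveGenerators d p) h ∧ h ∈ normalCone (projPolytope W S) u := by
  obtain ⟨h, h1, h2⟩ := exists_mem_forall_dotProduct_ne_zero (primitiveGenerators d p) realVec
    (fun g hg => by rw [Ne, realVec_eq_zero]; exact ne_zero_of_mem_primitiveGenerators hg)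
    (isOpen_normalCone_convexHull (hS.finite_image W) u)
    (normalCone_nonempty (hS.finite_image W) hu)
  exact ⟨h, h2, h1⟩

theorem numVertices_eq_encard (d p : ℕ) :
    (numVertices d p : ℕ∞) = (vertices (primitiveZonotope d p)).encard :=
  (finite_vertices_zonotope (primitiveGenerators d p)).cast_ncard_eq

/-- Refinement maps the vertices of the zonotope to those of the projection. The map is onto: the
normal cone at any vertex u contains a generic h, and the vertex assigned to the chamber of h must
be u, since normal cones at different vertices are disjoint. -/
theorem encard_vertices_projPolytope_le {p : ℕ} {S : Set (Fin n → ℤ)} (hS : IsMatroid S)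
    {W : Matrix (Fin d) (Fin n) ℤ} (hW : IsBoundedUtility p W) :
    (vertices (projPolytope W S)).encard ≤ numVertices d p := by
  rw [numVertices_eq_encard]
  choose φ h1 h2 using refines_projPolytope hS hW
  classical
  let ψ : (Fin d → ℝ) → Fin d → ℝ := fun v =>
    if hv : v ∈ vertices (primitiveZonotope d p) then φ v hv else 0
  refine le_trans (Set.encard_le_encard (t := ψ '' vertices (primitiveZonotope d p)) ?_)
    (Set.encard_image_le _ _)
  intro u hu
  obtain ⟨h, hg, hh⟩ := exists_generic_mem_normalCone p hS W hu
  have hv := hg.mem_vertices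
  refine ⟨_, hv, ?_⟩
  rw [← primitiveZonotope_eq] at hv
  simp only [ψ, dif_pos hv]
  exact normalCone_inter_unique (h1 _ hv).1 hu.1 (h2 _ hv hg.mem_normalCone) hh

end Refinement

/-! ### The primitive zonotope as a projection of a matroid -/

section Transversal

/-- The matroid whose bases are the transversals of a partition. -/
def transversalMatroid {α ι : Type*} [Finite α] (π : α → ι) (hπ : Function.Surjective π) :
    Matroid α :=
  Matroid.ofIsBaseOfFinite (E := Set.univ) Set.finite_univ
    (fun B => ∀ i, ∃! j, j ∈ B ∧ π j = i)
    (by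
      obtain ⟨σ, hσ⟩ := hπ.hasRightInverse
      refine ⟨Set.range σ, fun i => ⟨σ i, ⟨⟨i, rfl⟩, hσ i⟩, ?_⟩⟩
      rintro _ ⟨⟨k, rfl⟩, rfl⟩
      rw [hσ k])
    (by
      intro B B' hB hB' a ha
      -- Exchange a for the element of B' in the same block.
      obtain ⟨b, ⟨hb, hba⟩, hbu⟩ := hB' (π a)
      have hbB : b ∉ B := fun h => by
        have := (hB (π a)).unique ⟨h, hba⟩ ⟨ha.1, rfl⟩
        exact ha.2 (this ▸ hb)
      refine ⟨b, ⟨hb, hbB⟩, fun i => ?_⟩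
      by_cases hi : i = π a
      · subst hi
        refine ⟨b, ⟨Or.inl rfl, hba⟩, ?_⟩
        rintro c ⟨rfl | hc, hca⟩
        · rfl
        · exact absurd ((hB (π a)).unique ⟨hc.1, hca⟩ ⟨ha.1, rfl⟩) hc.2
      · obtain ⟨c, ⟨hc, hci⟩, hcu⟩ := hB i
        refine ⟨c, ⟨Or.inr ⟨hc, fun h => hi ?_⟩, hci⟩, ?_⟩
        · rw [← hci, Set.mem_singleton_iff.1 h]
        · rintro e ⟨rfl | he, hei⟩
          · exact absurd (hei.symm.trans hba) hi
          · exact hcu e ⟨he.1, hei⟩)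
    (fun _ _ => Set.subset_univ _)

open scoped Pointwise in
theorem mem_sum_pair_iff {d : ℕ} (s : Finset (Fin d → ℤ)) (x : Fin d → ℝ) :
    x ∈ ∑ g ∈ s, ({0, realVec g} : Set (Fin d → ℝ)) ↔
      ∃ T ⊆ s, x = ∑ g ∈ T, realVec g := by
  classical
  rw [Set.mem_finsetSum]
  constructor
  · rintro ⟨f, hf, rfl⟩
    refine ⟨s.filter fun g => f g = realVec g, Finset.filter_subset _ _, ?_⟩
    rw [Finset.sum_filter]
    refine Finset.sum_congr rfl fun g hg => ?_
    rcases hf hg with h | h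
    · split_ifs with h'
      · exact h'
      · exact h
    · rw [Set.mem_singleton_iff.1 h]; simp
  · rintro ⟨T, hT, rfl⟩
    refine ⟨fun g => if g ∈ T then realVec g else 0, fun {g} _ => ?_, ?_⟩
    · dsimp only; split_ifs <;> simp
    · rw [← Finset.sum_filter, Finset.filter_mem_eq_inter, Finset.inter_eq_right.2 hT]

theorem primitiveGenerators_nonempty {d p : ℕ} (hd : 0 < d) (hp : 0 < p) :
    (primitiveGenerators d p).Nonempty := by
  obtain ⟨g, hg, _⟩ := exists_primitive_multiple (d := d) (p := p) (v := fun _ => 1)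
    (fun h => by simpa using congrFun h ⟨0, hd⟩) (fun i => by simp; omega)
  exact ⟨g, hg⟩

theorem convexHull_translate {d : ℕ} (t : Fin d → ℝ) (F : Set (Fin d → ℝ)) :
    (fun x => t + x) '' convexHull ℝ F = convexHull ℝ ((fun x => t + x) '' F) :=
  (AffineEquiv.constVAdd ℝ (Fin d → ℝ) t).toAffineMap.image_convexHull F

/-- The element `(g, true)` carries the positive part of g and `(g, false)` the negative part, both
with entries in {0,…,p}. Their difference is g, so a transversal projects to the sum b of all
negative parts plus the sum of the generators chosen with `true`. -/
theorem exists_projPolytope_translate {d p : ℕ} (hd : 0 < d) (hp : 0 < p) :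
    ∃ (n : ℕ) (S : Set (Fin n → ℤ)) (W : Matrix (Fin d) (Fin n) ℤ),
      0 < n ∧ IsMatroid S ∧ IsBoundedUtility p W ∧
        ∃ t : Fin d → ℝ, primitiveZonotope d p = (fun x => t + x) '' projPolytope W S := by
  classical
  set s := primitiveGenerators d p with hs
  obtain ⟨g₀, hg₀⟩ := primitiveGenerators_nonempty hd hp
  let e := Fintype.equivFin (s × Bool)
  let π : Fin (Fintype.card (s × Bool)) → s := fun j => (e.symm j).1
  have hπ : Function.Surjective π := fun g => ⟨e (g, true), by simp [π]⟩
  let W : Matrix (Fin d) (Fin (Fintype.card (s × Bool))) ℤ := Matrix.of fun i j =>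
    if (e.symm j).2 then max ((e.symm j).1.1 i) 0 else max (-(e.symm j).1.1 i) 0
  let S : Set (Fin (Fintype.card (s × Bool)) → ℤ) :=
    {x | ∃ B, (transversalMatroid π hπ).IsBase B ∧ x = B.indicator fun _ => (1 : ℤ)}
  let b : Fin d → ℤ := ∑ g : s, fun i => max (-g.1 i) 0
  have hbase : ∀ B, (transversalMatroid π hπ).IsBase B ↔ ∀ i, ∃! j, j ∈ B ∧ π j = i :=
    fun B => Iff.rfl
  have hmul : ∀ B, (transversalMatroid π hπ).IsBase B →
      W.mulVec (B.indicator fun _ => (1 : ℤ)) =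
        b + ∑ g : s, if e (g, true) ∈ B then g.1 else 0 := by
    intro B hB
    rw [hbase] at hB
    have h1 : ∀ g : s, e (g, false) ∈ B ↔ e (g, true) ∉ B := by
      intro g
      obtain ⟨j, ⟨hj, hjg⟩, hu⟩ := hB g
      have hje : j = e (g, (e.symm j).2) := by
        rw [← hjg]; simp [π]
      constructor
      · intro hf ht
        have := (hB g).unique ⟨hf, by simp [π]⟩ ⟨ht, by simp [π]⟩
        simp at this
      · intro ht
        cases hb : (e.symm j).2 with
        | false => rw [hb] at hje; rwa [← hje]
        | true => rw [hb] at hje; rw [← hje] at ht; exact absurd hj ht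
    ext i
    have h2 : W.mulVec (B.indicator fun _ => (1 : ℤ)) i =
        ∑ gs : s × Bool, W i (e gs) * B.indicator (fun _ => (1 : ℤ)) (e gs) := by
      rw [Matrix.mulVec, dotProduct, ← Equiv.sum_comp e]
    rw [h2, Fintype.sum_prod_type, Pi.add_apply]
    simp only [b, Finset.sum_apply, ← Finset.sum_add_distrib]
    refine Finset.sum_congr rfl fun g _ => ?_
    have h3 := h1 g
    by_cases ht : e (g, true) ∈ B
    · have hf : e (g, false) ∉ B := fun h => (h3.1 h) ht
      simp only [Fintype.sum_bool, Set.indicator_of_mem ht, Set.indicator_of_notMem hf, if_pos ht,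
        W, Matrix.of_apply, Equiv.symm_apply_apply]
      simp only [if_true, mul_one, mul_zero, add_zero]
      rcases le_total (g.1 i) 0 with h | h
      · rw [max_eq_right h, max_eq_left (by omega)]; omega
      · rw [max_eq_left h, max_eq_right (by omega)]; omega
    · have hf : e (g, false) ∈ B := h3.2 ht
      simp [Set.indicator_of_mem hf, ht, W]
  refine ⟨Fintype.card (s × Bool), S, W, Fintype.card_pos_iff.2 ⟨(⟨g₀, hg₀⟩, true)⟩,
    ⟨transversalMatroid π hπ, rfl, rfl⟩, ?_, -realVec b, ?_⟩
  · intro i j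
    have := (mem_primitiveGenerators.1 (e.symm j).1.2).1 i
    rw [abs_le] at this
    simp only [W, Matrix.of_apply]
    split_ifs
    · exact ⟨le_max_right _ _, max_le (by omega) (by omega)⟩
    · exact ⟨le_max_right _ _, max_le (by omega) (by omega)⟩
  · rw [projPolytope, convexHull_translate, primitiveZonotope_eq, zonotope_eq_convexHull]
    congr 1
    ext x
    rw [mem_sum_pair_iff]
    simp only [Set.mem_image, exists_exists_and_eq_and]
    constructor
    · rintro ⟨T, hT, rfl⟩
      -- The transversal that takes `(g, true)` exactly for the g in T.
      let B : Set (Fin (Fintype.card (s × Bool))) := {j | (e.symm j).2 = decide ((π j).1 ∈ T)}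
      have hB : (transversalMatroid π hπ).IsBase B := by
        rw [hbase]
        intro g
        refine ⟨e (g, decide (g.1 ∈ T)), ⟨by simp [B, π], by simp [π]⟩, ?_⟩
        rintro j ⟨hj, rfl⟩
        have hj' : (e.symm j).2 = decide ((π j).1 ∈ T) := hj
        rw [← hj']; simp [π]
      refine ⟨_, ⟨B, hB, rfl⟩, ?_⟩
      rw [hmul B hB, realVec_add, neg_add_cancel_left, realVec_sum]
      have h4 : ∑ g ∈ T, realVec g = ∑ g : s, if g.1 ∈ T then realVec g.1 else 0 := by
        rw [Finset.sum_coe_sort s fun g => if g ∈ T then realVec g else 0, ← Finset.sum_filter,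
          Finset.filter_mem_eq_inter, Finset.inter_eq_right.2 hT]
      rw [h4]
      refine Finset.sum_congr rfl fun g _ => ?_
      have h5 : e (g, true) ∈ B ↔ g.1 ∈ T := by simp [B, π]
      by_cases hg : g.1 ∈ T
      · rw [if_pos (h5.2 hg), if_pos hg]
      · rw [if_neg (fun h => hg (h5.1 h)), if_neg hg, realVec_eq_zero]
    · rintro ⟨_, ⟨B, hB, rfl⟩, rfl⟩
      rw [hmul B hB, realVec_add, neg_add_cancel_left, realVec_sum]
      let φ : (Fin d → ℤ) → Prop := fun g => ∃ h : g ∈ s, e (⟨g, h⟩, true) ∈ B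
      refine ⟨s.filter φ, Finset.filter_subset _ _, ?_⟩
      rw [Finset.sum_filter, ← Finset.sum_coe_sort s]
      refine Finset.sum_congr rfl fun g _ => ?_
      have h5 : φ g.1 ↔ e (g, true) ∈ B := ⟨fun ⟨_, h⟩ => h, fun h => ⟨g.2, h⟩⟩
      by_cases hg : φ g.1
      · rw [if_pos (h5.1 hg), if_pos hg]
      · rw [if_neg (fun h => hg (h5.2 h)), if_neg hg, realVec_eq_zero]

theorem isGreatest_encard_vertices {d p : ℕ} (hd : 0 < d) (hp : 0 < p) :
    IsGreatest
      {N : ℕ∞ | ∃ (n : ℕ) (S : Set (Fin n → ℤ)) (W : Matrix (Fin d) (Fin n) ℤ),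
        0 < n ∧ IsMatroid S ∧ IsBoundedUtility p W ∧
          N = (vertices (projPolytope W S)).encard}
      (numVertices d p : ℕ∞) := by
  constructor
  · obtain ⟨n, S, W, hn, hS, hW, t, ht⟩ := exists_projPolytope_translate hd hp
    refine ⟨n, S, W, hn, hS, hW, ?_⟩
    rw [numVertices_eq_encard, ht, vertices_translate,
      (add_right_injective t).encard_image]
  · rintro _ ⟨n, S, W, _, hS, hW, rfl⟩
    exact encard_vertices_projPolytope_le hS hW

end Transversal

/-! ### Small integer points of the chambers -/

section SmallIntegerPoint

variable {d : ℕ}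

/-- If a system `y · a > 0` whose coefficient vectors have full rank is feasible, the system
`y · a ≥ 1` is solved by some `y` whose tight constraints have full rank. -/
theorem exists_tight_feasible (A : Finset (Fin d → ℝ))
    (hspan : ∀ u, (∀ a ∈ A, dotProduct u a = 0) → u = 0)
    {h : Fin d → ℝ} (hh : ∀ a ∈ A, 0 < dotProduct h a) :
    ∃ y : Fin d → ℝ, (∀ a ∈ A, 1 ≤ dotProduct y a) ∧
      ∀ u, (∀ a ∈ A, dotProduct y a = 1 → dotProduct u a = 0) → u = 0 := by
  classical
  -- Scaling h by the sum of all reciprocals of its products makes every product at least 1.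
  have hfeas : {y : Fin d → ℝ | ∀ a ∈ A, 1 ≤ dotProduct y a}.Nonempty := by
    refine ⟨(∑ a ∈ A, 1 / dotProduct h a) • h, fun a ha => ?_⟩
    rw [smul_dotProduct, smul_eq_mul]
    have h1 : 1 / dotProduct h a ≤ ∑ a ∈ A, 1 / dotProduct h a :=
      Finset.single_le_sum (f := fun a => 1 / dotProduct h a)
        (fun b hb => (one_div_pos.2 (hh b hb)).le) ha
    calc (1 : ℝ) = 1 / dotProduct h a * dotProduct h a := by
          rw [one_div, inv_mul_cancel₀ (hh a ha).ne']
      _ ≤ _ := mul_le_mul_of_nonneg_right h1 (hh a ha).le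
  -- Choose a feasible y with as many tight constraints as possible. If they had deficient rank, one
  -- could move along a direction orthogonal to all of them until a further constraint became tight.
  obtain ⟨y, hy, hmin⟩ := (measure fun y : Fin d → ℝ =>
    A.card - (A.filter fun a => dotProduct y a = 1).card).wf.has_min _ hfeas
  refine ⟨y, hy, fun u hu => ?_⟩
  by_contra hne
  have hneg : ∃ u : Fin d → ℝ, (∀ a ∈ A, dotProduct y a = 1 → dotProduct u a = 0) ∧
      ∃ a ∈ A, dotProduct u a < 0 := by
    have : ∃ a ∈ A, dotProduct u a ≠ 0 := by
      by_contra h'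
      push Not at h'
      exact hne (hspan u h')
    obtain ⟨a, ha, h0⟩ := this
    rcases h0.lt_or_gt with h0 | h0
    · exact ⟨u, hu, a, ha, h0⟩
    · exact ⟨-u, fun b hb h1 => by rw [neg_dotProduct, hu b hb h1, neg_zero], a, ha, by
        rw [neg_dotProduct]; linarith⟩
  obtain ⟨v, hv, a₀, ha₀, hneg⟩ := hneg
  -- The ratio test: among the constraints that decrease along v, the one that becomes tight first.
  obtain ⟨a, ha, hamin⟩ := Finset.exists_min_image (A.filter fun a => dotProduct v a < 0)
    (fun a => (dotProduct y a - 1) / -dotProduct v a) ⟨a₀, by simp [ha₀, hneg]⟩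
  simp only [Finset.mem_filter] at ha hamin
  set t := (dotProduct y a - 1) / -dotProduct v a with ht
  have ht0 : 0 ≤ t := div_nonneg (by linarith [hy a ha.1]) (by linarith [ha.2])
  have hy' : y + t • v ∈ {y : Fin d → ℝ | ∀ a ∈ A, 1 ≤ dotProduct y a} := by
    intro b hb
    rw [add_dotProduct, smul_dotProduct, smul_eq_mul]
    rcases lt_or_ge (dotProduct v b) 0 with hb0 | hb0
    · have := hamin b ⟨hb, hb0⟩
      rw [le_div_iff₀ (by linarith)] at this
      linarith
    · have := hy b hb
      nlinarith [mul_nonneg ht0 hb0]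
  refine hmin _ hy' ?_
  have hsub : (A.filter fun a => dotProduct y a = 1) ⊂
      A.filter fun a => dotProduct (y + t • v) a = 1 := by
    rw [Finset.ssubset_iff_of_subset]
    · refine ⟨a, Finset.mem_filter.2 ⟨ha.1, ?_⟩, fun h => ?_⟩
      · have h2 : dotProduct v a ≠ 0 := ha.2.ne
        rw [add_dotProduct, smul_dotProduct, smul_eq_mul, ht]
        field_simp
        ring
      · have := hv a ha.1 (Finset.mem_filter.1 h).2
        linarith [ha.2]
    · intro b hb
      rw [Finset.mem_filter] at hb ⊢
      refine ⟨hb.1, ?_⟩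
      rw [add_dotProduct, smul_dotProduct, hv b hb.1 hb.2, hb.2]; simp
  have h1 := Finset.card_lt_card hsub
  have h2 := Finset.card_le_card (Finset.filter_subset (fun a => dotProduct (y + t • v) a = 1) A)
  change A.card - _ < A.card - _
  omega

/-- If a system of strict homogeneous inequalities with integer coefficients of absolute value at
most `p` is feasible, it has an integer solution with entries at most `d! p^d`. -/
theorem exists_small_integer_point {p : ℕ} (hp : 0 < p) (A : Finset (Fin d → ℤ))
    (hA : ∀ a ∈ A, ∀ i, |a i| ≤ p)
    (hspan : ∀ u : Fin d → ℝ, (∀ a ∈ A, dotProduct u (realVec a) = 0) → u = 0)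
    {h : Fin d → ℝ} (hh : ∀ a ∈ A, 0 < dotProduct h (realVec a)) :
    ∃ z : Fin d → ℤ, (∀ i, |z i| ≤ (d.factorial * p ^ d : ℕ)) ∧ ∀ a ∈ A, 0 < dotProduct z a := by
  classical
  obtain ⟨y, hy, htight⟩ := exists_tight_feasible (A.image realVec)
    (by simpa [Finset.forall_mem_image] using hspan) (h := h)
    (by simpa [Finset.forall_mem_image] using hh)
  simp only [Finset.forall_mem_image] at hy htight
  set T : Set (Fin d → ℝ) := {b | ∃ a ∈ A, b = realVec a ∧ dotProduct y (realVec a) = 1} with hT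
  -- A functional vanishing on all tight vectors is zero by `htight`. So d of these vectors can be
  -- chosen as the rows of an invertible integer matrix M, and M y is the all-ones vector.
  have htop : Submodule.span ℝ T = ⊤ := by
    by_contra hne
    obtain ⟨f, hf0, hf⟩ := Submodule.exists_le_ker_of_lt_top _ (lt_top_iff_ne_top.2 hne)
    obtain ⟨u, hu⟩ := exists_dotProduct_eq (LinearMap.toContinuousLinearMap f)
    have : u = 0 := htight u fun a ha h1 => by
      rw [← hu]
      exact hf (Submodule.subset_span ⟨a, ha, rfl, h1⟩)
    refine hf0 (LinearMap.ext fun x => ?_)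
    rw [this] at hu
    simpa using hu x
  obtain ⟨f, hfT, -, hli⟩ := Submodule.exists_fun_fin_finrank_span_eq ℝ T
  have hrank : Module.finrank ℝ (Submodule.span ℝ T) = d := by rw [htop]; simp
  let e : Fin d ≃ Fin (Module.finrank ℝ (Submodule.span ℝ T)) := finCongr hrank.symm
  choose a haA haf hay using fun i => hfT (e i)
  let M : Matrix (Fin d) (Fin d) ℤ := Matrix.of a
  have hrow : (M.map (Int.cast : ℤ → ℝ)).row = f ∘ e := by
    ext i j; simp [M, haf, realVec]
  have hdet : (M.map (Int.cast : ℤ → ℝ)).det ≠ 0 := by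
    have h1 : LinearIndependent ℝ (M.map (Int.cast : ℤ → ℝ)).row := by
      rw [hrow]; exact hli.comp _ e.injective
    exact ((Matrix.isUnit_iff_isUnit_det _).1 (Matrix.linearIndependent_rows_iff_isUnit.1 h1)).ne_zero
  have hdetM : (M.map (Int.cast : ℤ → ℝ)).det = (M.det : ℝ) := by
    exact (Int.cast_det M).symm
  -- By Cramer's rule this integer vector is `M.det` times y.
  set z₀ : Fin d → ℤ := M.cramer 1 with hz₀
  have hz₀y : realVec z₀ = (M.det : ℝ) • y := by
    rw [← sub_eq_zero]
    refine Matrix.eq_zero_of_mulVec_eq_zero hdet ?_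
    ext i
    rw [Matrix.mulVec_sub, Matrix.mulVec_smul, Pi.sub_apply, Pi.smul_apply, Pi.zero_apply]
    have h1 : (M.map (Int.cast : ℤ → ℝ)).mulVec (realVec z₀) i = (M.det : ℝ) := by
      have h2 := congrFun (Matrix.mulVec_cramer M 1) i
      rw [← hz₀] at h2
      simp only [Matrix.mulVec, dotProduct, Pi.smul_apply, Pi.one_apply, smul_eq_mul,
        mul_one] at h2
      rw [← h2]
      simp [Matrix.mulVec, dotProduct, realVec]
    have h3 : (M.map (Int.cast : ℤ → ℝ)).mulVec y i = 1 := by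
      rw [← hay i, dotProduct_comm]; rfl
    rw [h1, h3]; simp
  have hdet0 : M.det ≠ 0 := fun h0 => hdet (by rw [hdetM, h0, Int.cast_zero])
  -- The sign makes the multiple of y positive, so that all inequalities are kept.
  refine ⟨M.det.sign • z₀, fun i => ?_, fun b hb => ?_⟩
  · have h1 : |z₀ i| ≤ (d.factorial * p ^ d : ℕ) := by
      rw [hz₀, Matrix.cramer_apply]
      -- The determinant bound d! p^d, for M with one column replaced by ones, which are at most p
      -- since p is positive.
      have := Matrix.det_le (abv := AbsoluteValue.abs) (A := M.updateCol i 1) (x := (p : ℤ)) (by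
        intro k l
        rw [Matrix.updateCol_apply]
        split_ifs
        · simp; omega
        · exact hA _ (haA k) l)
      simpa using this
    rw [Pi.smul_apply, smul_eq_mul, abs_mul, Int.abs_sign_of_ne_zero hdet0, one_mul]
    exact h1
  · have h1 : ((dotProduct (M.det.sign • z₀) b : ℤ) : ℝ) =
        (|M.det| : ℤ) * dotProduct y (realVec b) := by
      rw [smul_dotProduct, smul_eq_mul, Int.cast_mul, ← dotProduct_realVec, hz₀y,
        smul_dotProduct, smul_eq_mul, ← mul_assoc, ← Int.cast_mul, Int.sign_mul_self_eq_abs]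
    have h2 : (0 : ℝ) < ((|M.det| : ℤ) : ℝ) := by
      exact_mod_cast abs_pos.2 hdet0
    have h3 : (0 : ℝ) < ((dotProduct (M.det.sign • z₀) b : ℤ) : ℝ) := by
      rw [h1]; exact mul_pos h2 (by linarith [hy hb])
    exact_mod_cast h3

/-- The scalar products of `h` and `h'` with every nonzero integer vector of sup-norm at most `p`
have the same sign and do not vanish. -/
def SameChamber (p : ℕ) (h h' : Fin d → ℤ) : Prop :=
  ∀ v : Fin d → ℤ, (∀ i, |v i| ≤ p) → v ≠ 0 → 0 < dotProduct h v * dotProduct h' v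

/-- `SameChamber` translates "generic with the same zonotope vertex" into a finite test in integer
arithmetic, which a program can carry out. It includes genericity, so it is reflexive on generic
vectors only. -/
theorem sameChamber_iff {p : ℕ} {h h' : Fin d → ℤ} :
    SameChamber p h h' ↔ IsGeneric (primitiveGenerators d p) (realVec h) ∧
      IsGeneric (primitiveGenerators d p) (realVec h') ∧
      zonotopeVertex (primitiveGenerators d p) (realVec h) =
        zonotopeVertex (primitiveGenerators d p) (realVec h') := by
  constructor
  · intro H
    have H' : ∀ g ∈ primitiveGenerators d p, 0 < dotProduct h g * dotProduct h' g := fun g hg =>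
      H g (mem_primitiveGenerators.1 hg).1 (ne_zero_of_mem_primitiveGenerators hg)
    have h1 : IsGeneric (primitiveGenerators d p) (realVec h) := fun g hg h0 => by
      rw [dotProduct_realVec, Int.cast_eq_zero] at h0
      have := H' g hg
      rw [h0, zero_mul] at this
      exact lt_irrefl _ this
    refine ⟨h1, fun g hg h0 => ?_, (zonotopeVertex_eq_iff h1).2 fun g hg => ?_⟩
    · rw [dotProduct_realVec, Int.cast_eq_zero] at h0
      have := H' g hg
      rw [h0, mul_zero] at this
      exact lt_irrefl _ this
    · rw [dotProduct_realVec, dotProduct_realVec, Int.cast_pos, Int.cast_pos]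
      exact pos_iff_pos_of_mul_pos (H' g hg)
  · rintro ⟨h1, h2, h3⟩ v hv hv0
    have := dotProduct_mul_pos_of_zonotopeVertex_eq h1 h2 h3 hv hv0
    rw [dotProduct_realVec, dotProduct_realVec] at this
    exact_mod_cast this

/-- Every chamber contains an integer vector with entries at most `d! p^d`. -/
theorem exists_small_chamber_point {p : ℕ} (hp : 0 < p) {h : Fin d → ℝ}
    (hh : IsGeneric (primitiveGenerators d p) h) :
    ∃ z : Fin d → ℤ, (∀ i, |z i| ≤ (d.factorial * p ^ d : ℕ)) ∧
      IsGeneric (primitiveGenerators d p) (realVec z) ∧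
      zonotopeVertex (primitiveGenerators d p) (realVec z) =
        zonotopeVertex (primitiveGenerators d p) h := by
  classical
  -- Flipping generators by the sign of their product with h describes the chamber by strict
  -- positive inequalities.
  set σ : (Fin d → ℤ) → ℤ := fun g => if 0 < dotProduct h (realVec g) then 1 else -1 with hσ
  have hσ1 : ∀ g, |σ g| = 1 := fun g => by simp only [hσ]; split_ifs <;> simp
  have hcast : ∀ g, realVec (σ g • g) = (σ g : ℝ) • realVec g := fun g => by
    ext; simp [realVec]
  obtain ⟨z, hz, hzA⟩ := exists_small_integer_point hp
    ((primitiveGenerators d p).image fun g => σ g • g) (h := h)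
    (by
      simp only [Finset.forall_mem_image]
      intro g hg i
      rw [Pi.smul_apply, smul_eq_mul, abs_mul, hσ1, one_mul]
      exact (mem_primitiveGenerators.1 hg).1 i)
    (by
      simp only [Finset.forall_mem_image]
      intro u hu
      ext i
      -- Each unit vector is a multiple of a generator, so the generators have full rank.
      obtain ⟨g, hg, c, hc, hcg⟩ := exists_primitive_multiple (p := p) (v := Pi.single i 1)
        (fun h => by simpa using congrFun h i) (fun j => by
          by_cases hij : j = i
          · subst hij; simp; omega
          · simp [hij])
      have h1 := hu hg
      rw [hcast, dotProduct_smul, smul_eq_mul] at h1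
      have h2 : dotProduct u (realVec g) = 0 := by
        refine (mul_eq_zero.1 h1).resolve_left fun h0 => ?_
        have := hσ1 g
        rw [Int.cast_eq_zero] at h0
        simp [h0] at this
      have h3 : realVec (Pi.single i (1 : ℤ)) = (c : ℝ) • realVec g := by
        rw [hcg]; ext; simp [realVec]
      have h4 : realVec (Pi.single i (1 : ℤ)) = Pi.single i (1 : ℝ) := by
        ext j; by_cases hij : j = i
        · subst hij; simp [realVec]
        · simp [realVec, hij]
      have h5 : dotProduct u (Pi.single i (1 : ℝ)) = 0 := by
        rw [← h4, h3, dotProduct_smul, h2, smul_zero]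
      simpa using h5)
    (by
      simp only [Finset.forall_mem_image]
      intro g hg
      rw [hcast, dotProduct_smul, smul_eq_mul]
      simp only [hσ]
      split_ifs with h0
      · simpa using h0
      · have := lt_of_le_of_ne (not_lt.1 h0) (hh g hg)
        simpa using this)
  simp only [Finset.forall_mem_image] at hzA
  have key : ∀ g ∈ primitiveGenerators d p, dotProduct (realVec z) (realVec g) ≠ 0 ∧
      (0 < dotProduct (realVec z) (realVec g) ↔ 0 < dotProduct h (realVec g)) := by
    intro g hg
    have := hzA hg
    rw [dotProduct_smul, smul_eq_mul] at this
    rw [dotProduct_realVec, Int.cast_ne_zero, Int.cast_pos]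
    simp only [hσ] at this
    split_ifs at this with h0
    · exact ⟨by omega, iff_of_true (by omega) h0⟩
    · exact ⟨by omega, iff_of_false (by omega) h0⟩
  have hgen : IsGeneric (primitiveGenerators d p) (realVec z) := fun g hg => (key g hg).1
  exact ⟨z, hz, hgen, (zonotopeVertex_eq_iff hgen).2 fun g hg => (key g hg).2⟩

end SmallIntegerPoint

/-! ### Reasoning about programs -/

section Memory

theorem Mem.put_apply (M : Mem) (a : ℕ) (i z : ℤ) (b : ℕ) (j : ℤ) :
    M.put a i z b j = if b = a ∧ j = i then z else M b j := by
  unfold Mem.put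
  by_cases h : b = a
  · subst h
    by_cases h' : j = i
    · subst h'; simp
    · simp [h']
  · simp [h]

theorem Mem.put_of_ne (M : Mem) {a b : ℕ} (i z : ℤ) (h : b ≠ a) : M.put a i z b = M b := by
  unfold Mem.put; simp [h]

theorem arrayOf_apply {n : ℕ} (x : Fin n → ℤ) (j : Fin n) : arrayOf x (j : ℤ) = x j := by
  unfold arrayOf
  refine Function.Injective.extend_apply (f := fun j : Fin n => (j : ℤ)) ?_ _ _ j
  intro i j h
  exact Fin.ext (by simpa using h)

theorem truth_eq_one {b : Prop} (h : b) : truth b = 1 := by simp [truth, h]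

theorem truth_eq_zero {b : Prop} (h : ¬ b) : truth b = 0 := by simp [truth, h]

/-- The expression for cell `0` of an array. -/
def Expr.var (a : ℕ) : Expr := .cell a (.const 0)

@[simp] theorem Expr.eval_var (M : Mem) (a : ℕ) : (Expr.var a).eval M = M a 0 := rfl

/-- The sum of the expressions `f 0, …, f (m - 1)`. -/
def Expr.sum (f : ℕ → Expr) : ℕ → Expr
  | 0 => .const 0
  | m + 1 => .add (Expr.sum f m) (f m)

@[simp] theorem Expr.eval_sum (M : Mem) (f : ℕ → Expr) (m : ℕ) :
    (Expr.sum f m).eval M = ∑ i ∈ Finset.range m, (f i).eval M := by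
  induction m with
  | zero => rfl
  | succ m ih => rw [Finset.sum_range_succ, ← ih]; rfl

/-- The power of an expression. -/
def Expr.pow (e : Expr) : ℕ → Expr
  | 0 => .const 1
  | m + 1 => .mul (Expr.pow e m) e

@[simp] theorem Expr.eval_pow (M : Mem) (e : Expr) (m : ℕ) :
    (Expr.pow e m).eval M = e.eval M ^ m := by
  induction m with
  | zero => simp [Expr.pow, Expr.eval]
  | succ m ih => rw [pow_succ, ← ih]; rfl

end Memory

attribute [simp] Expr.eval

/-! ### Time bounds from the program text, and proof rules for programs -/

section Logic

variable {Q : Type}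

/-- A bound on the number of operations of a program all of whose loops have at most `L` rounds and
all of whose queries cost at most `q`. -/
def Prog.bound (L q : ℕ) : Prog Q → ℕ
  | .nop => 0
  | .assign _ i e => i.ops + e.ops + 1
  | .seq P P' => P.bound L q + P'.bound L q
  | .ifle e e' P P' => e.ops + e'.ops + 1 + (P.bound L q + P'.bound L q)
  | .loop _ e P => e.ops + 1 + L * (1 + P.bound L q)
  | .ask _ => q

/-- By induction on the text: sequencing adds bounds, and a loop multiplies by at most L. The
constants depend on the program alone, which makes the bound uniform over all inputs. -/
theorem Prog.bound_le (P : Prog Q) :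
    ∃ C k : ℕ, ∀ L q : ℕ, 0 < L → 0 < q → P.bound L q ≤ C * (L * q) ^ k := by
  induction P with
  | nop => exact ⟨0, 0, by simp [Prog.bound]⟩
  | assign a i e => exact ⟨i.ops + e.ops + 1, 0, by simp [Prog.bound]⟩
  | ask q => exact ⟨1, 1, fun L q hL _ => by
      simpa [Prog.bound] using Nat.le_mul_of_pos_left q hL⟩
  | seq P P' ih ih' =>
    obtain ⟨C, k, h⟩ := ih
    obtain ⟨C', k', h'⟩ := ih'
    refine ⟨C + C', k + k', fun L q hL hq => ?_⟩
    have hLq : 0 < L * q := Nat.mul_pos hL hq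
    have h1 := h L q hL hq
    have h2 := h' L q hL hq
    have h3 := Nat.pow_le_pow_right hLq (Nat.le_add_right k k')
    have h4 := Nat.pow_le_pow_right hLq (Nat.le_add_left k' k)
    have h5 := Nat.mul_le_mul_left C h3
    have h6 := Nat.mul_le_mul_left C' h4
    simp only [Prog.bound]
    rw [add_mul]
    omega
  | ifle e e' P P' ih ih' =>
    obtain ⟨C, k, h⟩ := ih
    obtain ⟨C', k', h'⟩ := ih'
    refine ⟨e.ops + e'.ops + 1 + (C + C'), k + k', fun L q hL hq => ?_⟩
    have hLq : 0 < L * q := Nat.mul_pos hL hq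
    have h1 := h L q hL hq
    have h2 := h' L q hL hq
    have h3 := Nat.pow_le_pow_right hLq (Nat.le_add_right k k')
    have h4 := Nat.pow_le_pow_right hLq (Nat.le_add_left k' k)
    have h5 := Nat.mul_le_mul_left C h3
    have h6 := Nat.mul_le_mul_left C' h4
    have h7 := Nat.le_mul_of_pos_right (e.ops + e'.ops + 1) (Nat.pow_pos (n := k + k') hLq)
    simp only [Prog.bound]
    rw [add_mul, add_mul C]
    omega
  | loop v e P ih =>
    obtain ⟨C, k, h⟩ := ih
    refine ⟨e.ops + 1 + (1 + C), k + 1, fun L q hL hq => ?_⟩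
    have hLq : 0 < L * q := Nat.mul_pos hL hq
    have h1 := h L q hL hq
    have h2 : 1 ≤ (L * q) ^ k := Nat.pow_pos hLq
    have h3 : 1 ≤ (L * q) ^ (k + 1) := Nat.pow_pos hLq
    have h4 : L * (1 + P.bound L q) ≤ (1 + C) * (L * q) ^ (k + 1) :=
      calc L * (1 + P.bound L q) ≤ (L * q) * ((1 + C) * (L * q) ^ k) :=
            Nat.mul_le_mul (Nat.le_mul_of_pos_right L hq) (by rw [add_mul]; omega)
        _ = _ := by ring
    have h5 := Nat.le_mul_of_pos_right (e.ops + 1) h3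
    simp only [Prog.bound]
    rw [add_mul]
    omega

variable (O : Q → Mem → Mem) (c s : Q → Mem → ℕ) (L q : ℕ)

/-- The run of `P` on memory `M` obeys the time bound, and its final memory satisfies `R` together
with the count `k`, increased by the number of queries made that are counted by `s`. -/
def Prog.Meets (P : Prog Q) (M : Mem) (k : ℕ) (R : Mem → ℕ → Prop) : Prop :=
  P.charge O 1 c M ≤ P.bound L q ∧ R (P.exec O M) (k + P.charge O 0 s M)

variable {O c s L q} {P P' : Prog Q} {M : Mem} {k : ℕ} {R R' : Mem → ℕ → Prop}

theorem Prog.Meets.mono (h : P.Meets O c s L q M k R) (hR : ∀ M' k', R M' k' → R' M' k') :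
    P.Meets O c s L q M k R' := ⟨h.1, hR _ _ h.2⟩

theorem Prog.meets_nop (h : R M k) : (Prog.nop : Prog Q).Meets O c s L q M k R :=
  ⟨le_rfl, h⟩

theorem Prog.meets_assign {a : ℕ} {i e : Expr} (h : R (M.put a (i.eval M) (e.eval M)) k) :
    (Prog.assign a i e : Prog Q).Meets O c s L q M k R :=
  ⟨by simp [Prog.charge, Prog.bound], by simpa [Prog.charge, Prog.exec] using h⟩

theorem Prog.meets_seq (h : P.Meets O c s L q M k fun M' k' => P'.Meets O c s L q M' k' R) :
    (Prog.seq P P').Meets O c s L q M k R :=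
  ⟨Nat.add_le_add h.1 h.2.1, by
    have := h.2.2
    rwa [add_assoc] at this⟩

theorem Prog.meets_ifle {e e' : Expr} (h : e.eval M ≤ e'.eval M → P.Meets O c s L q M k R)
    (h' : e'.eval M < e.eval M → P'.Meets O c s L q M k R) :
    (Prog.ifle e e' P P').Meets O c s L q M k R := by
  simp only [Prog.Meets, Prog.charge, Prog.bound, Prog.exec]
  split_ifs with hle
  · have := h hle
    exact ⟨by linarith [this.1], by simpa using this.2⟩
  · have := h' (not_le.1 hle)
    exact ⟨by linarith [this.1], by simpa using this.2⟩

theorem Prog.meets_ask {r : Q} (hc : c r M ≤ q) (h : R (O r M) (k + s r M)) :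
    (Prog.ask r).Meets O c s L q M k R := ⟨hc, h⟩

/-- `I t` holds after t rounds, before the counter is written for the next one. The cost of a round
is bounded only on memories satisfying the invariant, so the invariant is established before the
time bound. -/
theorem Prog.meets_loop {v : ℕ} {e : Expr} {N : ℕ} (he : e.eval M = N) (hN : N ≤ L)
    (I : ℕ → Mem → ℕ → Prop) (h0 : I 0 M k)
    (hstep : ∀ t < N, ∀ M' k', I t M' k' → P.Meets O c s L q (M'.put v 0 t) k' (I (t + 1)))
    (hR : ∀ M' k', I N M' k' → R M' k') : (Prog.loop v e P).Meets O c s L q M k R := by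
  have hinv : ∀ t ≤ N, I t (loopMem (P.exec O) v M t)
      (k + ∑ j ∈ Finset.range t, P.charge O 0 s ((loopMem (P.exec O) v M j).put v 0 j)) := by
    intro t
    induction t with
    | zero => intro _; simpa [loopMem] using h0
    | succ t ih =>
      intro ht
      have := (hstep t ht _ _ (ih (by omega))).2
      rw [Finset.sum_range_succ, ← add_assoc]
      exact this
  have hto : (e.eval M).toNat = N := by rw [he]; simp
  refine ⟨?_, ?_⟩
  · simp only [Prog.charge, Prog.bound, hto, one_mul]
    refine Nat.add_le_add_left ?_ _
    calc _ ≤ ∑ j ∈ Finset.range N, (1 + P.bound L q) := by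
          refine Finset.sum_le_sum fun t ht => Nat.add_le_add_left ?_ 1
          have ht' := Finset.mem_range.1 ht
          exact (hstep t ht' _ _ (hinv t ht'.le)).1
      _ ≤ _ := by
          rw [Finset.sum_const, Finset.card_range, smul_eq_mul]
          exact Nat.mul_le_mul_right _ hN
  · apply hR
    have := hinv N le_rfl
    simpa [Prog.charge, Prog.exec, hto] using this

/-- The nested loops with the counters in the arrays `a 0, …, a (m - 1)`, the first one
innermost. -/
def Prog.nest (a : ℕ → ℕ) (e : Expr) (P : Prog Q) : ℕ → Prog Q
  | 0 => P
  | m + 1 => .loop (a m) e (Prog.nest a e P m)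

/-- Nested loops enumerate `t = 0, …, N ^ D - 1`, where the counters hold the base `N` digits
of `t`. -/
theorem Prog.meets_nest {a : ℕ → ℕ} (ha : Function.Injective a) {e : Expr} {N D : ℕ} (hN : N ≤ L)
    (I : ℕ → Mem → ℕ → Prop) (he : ∀ t M' k', I t M' k' → e.eval M' = N)
    (hput : ∀ t M' k', I t M' k' → ∀ i < D, ∀ z, I t (M'.put (a i) 0 z) k')
    (h0 : I 0 M k)
    (hstep : ∀ t < N ^ D, ∀ M' k', I t M' k' →
      (∀ i < D, M' (a i) 0 = ((t / N ^ i % N : ℕ) : ℤ)) →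
      P.Meets O c s L q M' k' fun M'' k'' => I (t + 1) M'' k'' ∧
        ∀ i < D, M'' (a i) 0 = M' (a i) 0)
    (hR : ∀ M' k', I (N ^ D) M' k' → R M' k') :
    (Prog.nest a e P D).Meets O c s L q M k R := by
  -- Generalization for the induction: the m innermost loops cover the block of t from `r * N ^ m`
  -- up to the next multiple of `N ^ m`, while the outer counters hold the higher digits, common to
  -- the block.
  have key : ∀ m ≤ D, ∀ r : ℕ, (r + 1) * N ^ m ≤ N ^ D → ∀ M k, I (r * N ^ m) M k →
      (∀ i, m ≤ i → i < D → M (a i) 0 = ((r * N ^ m / N ^ i % N : ℕ) : ℤ)) →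
      (Prog.nest a e P m).Meets O c s L q M k fun M' k' => I ((r + 1) * N ^ m) M' k' ∧
        ∀ i, m ≤ i → i < D → M' (a i) 0 = M (a i) 0 := by
    intro m
    induction m with
    | zero =>
      intro _ r hr M k hI hM
      simp only [pow_zero, mul_one, zero_le, true_imp_iff] at hr hI hM ⊢
      exact hstep r (by omega) M k hI hM
    | succ m ih =>
      intro hm r hr M k hI hM
      refine Prog.meets_loop (he _ _ _ hI) hN (fun t M' k' => I ((r * N + t) * N ^ m) M' k' ∧
        ∀ i, m + 1 ≤ i → i < D → M' (a i) 0 = M (a i) 0) ?_ ?_ ?_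
      · exact ⟨by rwa [add_zero, mul_assoc, ← pow_succ'], fun _ _ _ => rfl⟩
      · rintro t ht M' k' ⟨hI', hM'⟩
        have hput' : ∀ i, m + 1 ≤ i → (M'.put (a m) 0 t) (a i) 0 = M' (a i) 0 := by
          intro i hi
          rw [Mem.put_of_ne _ _ _ fun h => by have := ha h; omega]
        refine Prog.Meets.mono (ih (by omega) (r * N + t) ?_ _ k'
          (hput _ _ _ hI' m (by omega) t) ?_) ?_
        · refine le_trans ?_ hr
          rw [pow_succ', ← mul_assoc]
          refine Nat.mul_le_mul_right _ ?_
          rw [add_mul]; omega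
        · intro i hi hiD
          have hNpos : 0 < N := by omega
          rcases hi.eq_or_lt with rfl | hi
          · rw [Mem.put_apply, if_pos ⟨rfl, rfl⟩, Nat.mul_div_cancel _ (Nat.pow_pos hNpos),
              Nat.mul_add_mod', Nat.mod_eq_of_lt ht]
          -- The new digit t is less than N, so there is no carry into the higher digits.
          · rw [hput' i hi, hM' i hi hiD, hM i hi hiD]
            obtain ⟨j, rfl⟩ := Nat.exists_eq_add_of_le hi
            congr 2
            have e1 : N ^ (m.succ + j) = N ^ m * N * N ^ j := by rw [pow_add, Nat.pow_succ]
            rw [e1, pow_succ, ← Nat.div_div_eq_div_mul, ← Nat.div_div_eq_div_mul,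
              ← Nat.div_div_eq_div_mul, ← Nat.div_div_eq_div_mul,
              Nat.mul_div_cancel _ (Nat.pow_pos hNpos), mul_comm (N ^ m) N, ← mul_assoc,
              Nat.mul_div_cancel _ (Nat.pow_pos hNpos), Nat.mul_div_cancel _ hNpos]
            congr 1
            rw [mul_comm r, Nat.mul_add_div hNpos, Nat.div_eq_of_lt ht, add_zero]
        · rintro M'' k'' ⟨h1, h2⟩
          refine ⟨by rwa [← add_assoc], fun i hi hiD => ?_⟩
          rw [h2 i (by omega) hiD, hput' i hi, hM' i hi hiD]
      · rintro M' k' ⟨h1, h2⟩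
        refine ⟨?_, h2⟩
        rwa [pow_succ', ← mul_assoc, add_mul, one_mul]
  refine Prog.Meets.mono (key D le_rfl 0 (by simp) M k (by simpa using h0)
    fun i hi hiD => by omega) ?_
  rintro M' k' ⟨h1, _⟩
  exact hR _ _ (by simpa using h1)

end Logic

/-! ### The greedy algorithm as a program -/

section GreedyProgram

variable {n : ℕ}

theorem Mem.vec_put (M : Mem) (a : ℕ) (j : Fin n) (z : ℤ) :
    (M.put a (j : ℤ) z).vec n a = Function.update (M.vec n a) j z := by
  ext i
  by_cases h : i = j
  · subst h; simp [Mem.vec, Mem.put_apply]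
  · have : (i : ℤ) ≠ j := fun h' => h (Fin.ext (by exact_mod_cast h'))
    simp [Mem.vec, Mem.put_apply, h, this]

theorem Mem.vec_congr {M M' : Mem} {a : ℕ} (h : M' a = M a) : M'.vec n a = M.vec n a := by
  ext i; simp [Mem.vec, h]

theorem add_single_eq_update (y : Fin n → ℤ) (j : Fin n) :
    y + Pi.single j 1 = Function.update y j (y j + 1) := by
  ext i
  by_cases h : i = j
  · subst h; simp
  · simp [h]

/-- The step of the greedy algorithm restricted to the elements of rank `k`. -/
noncomputable def rankedStep (S : Set (Fin n → ℤ)) (w : Fin n → ℤ) (k : ℕ) (y : Fin n → ℤ)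
    (j : Fin n) : Fin n → ℤ :=
  if utilityRank w j = k then greedyStep S y j else y

/-- The greedy run rewritten as the double loop of the program: ranks outside, elements inside,
skipping elements of other ranks. -/
theorem greedyAlong_greedyOrder (S : Set (Fin n → ℤ)) (w : Fin n → ℤ) :
    greedyAlong S (greedyOrder w) =
      (List.range n).foldl (fun y k => (List.finRange n).foldl (rankedStep S w k) y) 0 := by
  rw [greedyAlong_eq, greedyOrder, List.foldl_flatMap]
  congr 1
  ext y k : 2
  rw [List.foldl_filter]
  congr 1
  ext y j : 2
  simp [rankedStep]

theorem foldl_take_finRange_succ {β : Type*} (f : β → Fin n → β) (y : β) {t : ℕ} (ht : t < n) :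
    ((List.finRange n).take (t + 1)).foldl f y =
      f (((List.finRange n).take t).foldl f y) ⟨t, ht⟩ := by
  rw [List.take_add_one, List.foldl_append]
  simp [ht]

/-- Compute the rank of the element in cell `0` of array `4` into array `6`. -/
def rankProg : Prog LinQuery :=
  .seq (.assign 6 (.const 0) (.const 0)) <|
    .loop 5 (.var 0) <|
      .ifle (.add (.cell 1 (.var 4)) (.const 1)) (.cell 1 (.var 5))
        (.assign 6 (.const 0) (.add (.var 6) (.const 1))) .nop

/-- Add the element in cell `0` of array `4` to the set in array `2` if the result is
independent. -/
def augmentProg : Prog LinQuery :=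
  .seq (.assign 2 (.var 4) (.add (.cell 2 (.var 4)) (.const 1))) <|
    .seq (.ask (.indep 2 7)) <|
      .ifle (.const 1) (.var 7) .nop
        (.assign 2 (.var 4) (.sub (.cell 2 (.var 4)) (.const 1)))

/-- The greedy algorithm, which considers the elements by increasing rank. -/
def greedyProg : Prog LinQuery :=
  .loop 3 (.var 0) <| .loop 4 (.var 0) <| .seq rankProg <|
    .ifle (.var 6) (.var 3) (.ifle (.var 3) (.var 6) augmentProg .nop) .nop

variable {S : Set (Fin n → ℤ)} {w : Fin n → ℤ} {M : Mem} {k : ℕ}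

/-- The memory holds the linear problem with utility vector `w`. -/
def HoldsLinear (w : Fin n → ℤ) (M : Mem) : Prop := M 0 0 = n ∧ ∀ j : Fin n, M 1 j = w j

theorem HoldsLinear.of_eq {M' : Mem} (h : HoldsLinear w M) (h0 : M' 0 = M 0) (h1 : M' 1 = M 1) :
    HoldsLinear w M' := by
  unfold HoldsLinear at h ⊢
  rwa [h0, h1]

theorem rankProg_meets (hM : HoldsLinear w M) (j : Fin n) (hj : M 4 0 = j) :
    rankProg.Meets (linOracle S) (fun _ _ => 1) (fun _ _ => 0) n 1 M k fun M' _ =>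
      (∀ b, b ≠ 5 → b ≠ 6 → M' b = M b) ∧ M' 6 0 = utilityRank w j := by
  refine Prog.meets_seq (Prog.meets_assign ?_)
  refine Prog.meets_loop (N := n) (by simp [Mem.put_apply, hM.1]) le_rfl
    (fun t M' _ => (∀ b, b ≠ 5 → b ≠ 6 → M' b = M b) ∧
      M' 6 0 = ((Finset.univ.filter fun i : Fin n => (i : ℕ) < t ∧ w j < w i).card : ℕ)) ?_ ?_ ?_
  · refine ⟨fun b _ h6 => Mem.put_of_ne _ _ _ h6, ?_⟩
    simp [Mem.put_apply]
  · rintro t ht M' k' ⟨hf, hr⟩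
    have h1 : M' 1 = M 1 := hf 1 (by decide) (by decide)
    have h4 : M' 4 = M 4 := hf 4 (by decide) (by decide)
    have ewj : (Expr.cell 1 (.var 4)).eval (M'.put 5 0 t) = w j := by
      simp [Mem.put_apply, h1, h4, hj, hM.2]
    have ewt : (Expr.cell 1 (.var 5)).eval (M'.put 5 0 t) = w ⟨t, ht⟩ := by
      have := hM.2 ⟨t, ht⟩
      simpa [Mem.put_apply, h1] using this
    have hfilter : (Finset.univ.filter fun i : Fin n => (i : ℕ) < t + 1 ∧ w j < w i) =
        if w j < w ⟨t, ht⟩ then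
          insert ⟨t, ht⟩ (Finset.univ.filter fun i : Fin n => (i : ℕ) < t ∧ w j < w i)
        else Finset.univ.filter fun i : Fin n => (i : ℕ) < t ∧ w j < w i := by
      ext i
      have hi : (i : ℕ) < t + 1 ↔ i = ⟨t, ht⟩ ∨ (i : ℕ) < t := by rw [Fin.ext_iff]; simp; omega
      split_ifs with hw
      · simp only [Finset.mem_filter, Finset.mem_univ, true_and, Finset.mem_insert, hi]
        constructor
        · rintro ⟨h | h, h'⟩
          · exact Or.inl h
          · exact Or.inr ⟨h, h'⟩
        · rintro (h | h)
          · exact ⟨Or.inl h, h ▸ hw⟩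
          · exact ⟨Or.inr h.1, h.2⟩
      · simp only [Finset.mem_filter, Finset.mem_univ, true_and, hi]
        constructor
        · rintro ⟨h | h, h'⟩
          · exact absurd (h ▸ h') hw
          · exact ⟨h, h'⟩
        · rintro h
          exact ⟨Or.inr h.1, h.2⟩
    -- Over the integers, the strict comparison of utilities is tested as `w j + 1 ≤ w i`.
    refine Prog.meets_ifle (fun hle => Prog.meets_assign ?_) (fun hlt => Prog.meets_nop ?_)
    · change (Expr.cell 1 (.var 4)).eval _ + 1 ≤ (Expr.cell 1 (.var 5)).eval _ at hle
      rw [ewj, ewt] at hle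
      refine ⟨fun b h5 h6 => ?_, ?_⟩
      · rw [Mem.put_of_ne _ _ _ h6, Mem.put_of_ne _ _ _ h5, hf b h5 h6]
      · rw [hfilter, if_pos (by omega), Finset.card_insert_of_notMem (by simp)]
        simp [Mem.put_apply, hr]
    · change (Expr.cell 1 (.var 5)).eval _ < (Expr.cell 1 (.var 4)).eval _ + 1 at hlt
      rw [ewj, ewt] at hlt
      refine ⟨fun b h5 h6 => ?_, ?_⟩
      · rw [Mem.put_of_ne _ _ _ h5, hf b h5 h6]
      · rw [hfilter, if_neg (by omega)]
        simp [Mem.put_apply, hr]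
  · rintro M' _ ⟨hf, hr⟩
    refine ⟨hf, ?_⟩
    rw [hr, utilityRank]
    congr 2
    ext i
    simp

/-- The element is added tentatively, so that the oracle can be asked about array `2` itself, and is
removed again after a negative answer. -/
theorem augmentProg_meets (j : Fin n) (hj : M 4 0 = j) :
    augmentProg.Meets (linOracle S) (fun _ _ => 1) (fun _ _ => 0) n 1 M k fun M' _ =>
      (∀ b, b ≠ 2 → b ≠ 7 → M' b = M b) ∧ M'.vec n 2 = greedyStep S (M.vec n 2) j := by
  have hvec : (M.put 2 (j : ℤ) (M 2 j + 1)).vec n 2 = M.vec n 2 + Pi.single j 1 := by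
    rw [Mem.vec_put, add_single_eq_update]; rfl
  refine Prog.meets_seq (Prog.meets_assign (Prog.meets_seq (Prog.meets_ask le_rfl ?_)))
  simp only [Expr.eval_var, Expr.eval, hj, linOracle]
  rw [hvec]
  refine Prog.meets_ifle (fun hle => Prog.meets_nop ?_) (fun hlt => Prog.meets_assign ?_)
  · refine ⟨fun b h2 h7 => by rw [Mem.put_of_ne _ _ _ h7, Mem.put_of_ne _ _ _ h2], ?_⟩
    rw [Mem.vec_congr (Mem.put_of_ne _ _ _ (by decide)), hvec, greedyStep, if_pos]
    by_contra h
    simp [Mem.put_apply, truth_eq_zero h] at hle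
  · refine ⟨fun b h2 h7 => by
      rw [Mem.put_of_ne _ _ _ h2, Mem.put_of_ne _ _ _ h7, Mem.put_of_ne _ _ _ h2], ?_⟩
    have h4 : ((M.put 2 (j : ℤ) (M 2 j + 1)).put 7 0
        (truth (Indep S (M.vec n 2 + Pi.single j 1)))) 4 0 = j := by
      simp [Mem.put_apply, hj]
    simp only [Expr.eval_var, Expr.eval, h4]
    rw [Mem.vec_put, Mem.vec_congr (Mem.put_of_ne _ _ _ (by decide)), Mem.vec_put, greedyStep,
      if_neg]
    · ext i
      by_cases h : i = j
      · subst h; simp [Mem.put_apply, Mem.vec]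
      · simp [h]
    · intro h
      simp [Mem.put_apply, truth_eq_one h] at hlt

theorem greedyProg_meets (hM : HoldsLinear w M) (h2 : M.vec n 2 = 0) :
    greedyProg.Meets (linOracle S) (fun _ _ => 1) (fun _ _ => 0) n 1 M k fun M' _ =>
      M'.vec n 2 = greedyAlong S (greedyOrder w) := by
  refine Prog.meets_loop (N := n) (by simp [hM.1]) le_rfl
    (fun t M' _ => HoldsLinear w M' ∧ M'.vec n 2 =
      (List.range t).foldl (fun y k => (List.finRange n).foldl (rankedStep S w k) y) 0) ?_ ?_ ?_
  · exact ⟨hM, by simpa using h2⟩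
  · rintro t ht M₁ k₁ ⟨hM₁, hy⟩
    refine Prog.meets_loop (N := n) (by simp [Mem.put_apply, hM₁.1]) le_rfl
      (fun u M' _ => HoldsLinear w M' ∧ M' 3 0 = t ∧ M'.vec n 2 =
        ((List.finRange n).take u).foldl (rankedStep S w t) (M₁.vec n 2)) ?_ ?_ ?_
    · refine ⟨hM₁.of_eq (Mem.put_of_ne _ _ _ (by decide)) (Mem.put_of_ne _ _ _ (by decide)),
        by simp [Mem.put_apply], ?_⟩
      rw [Mem.vec_congr (Mem.put_of_ne _ _ _ (by decide))]
      simp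
    · rintro u hu M₂ k₂ ⟨hM₂, h3, hy₂⟩
      have hM₃ : HoldsLinear w (M₂.put 4 0 u) :=
        hM₂.of_eq (Mem.put_of_ne _ _ _ (by decide)) (Mem.put_of_ne _ _ _ (by decide))
      refine Prog.meets_seq (Prog.Meets.mono
        (rankProg_meets hM₃ ⟨u, hu⟩ (by simp [Mem.put_apply])) ?_)
      rintro M₄ k₄ ⟨hf, hr⟩
      have hM₄ : HoldsLinear w M₄ :=
        hM₃.of_eq (hf 0 (by decide) (by decide)) (hf 1 (by decide) (by decide))
      have h3' : M₄ 3 0 = t := by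
        rw [hf 3 (by decide) (by decide)]; simpa [Mem.put_apply] using h3
      have h4 : M₄ 4 0 = u := by
        rw [hf 4 (by decide) (by decide)]; simp [Mem.put_apply]
      have hv : M₄.vec n 2 = M₂.vec n 2 := Mem.vec_congr (by
        rw [hf 2 (by decide) (by decide), Mem.put_of_ne _ _ _ (by decide)])
      rw [← hv] at hy₂
      have hskip : utilityRank w ⟨u, hu⟩ ≠ t → HoldsLinear w M₄ ∧ M₄ 3 0 = t ∧ M₄.vec n 2 =
          ((List.finRange n).take (u + 1)).foldl (rankedStep S w t) (M₁.vec n 2) := fun hne => by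
        refine ⟨hM₄, h3', ?_⟩
        rw [foldl_take_finRange_succ _ _ hu, ← hy₂, rankedStep, if_neg hne]
      -- The two comparisons together test that the rank equals the current round.
      refine Prog.meets_ifle (fun hle => Prog.meets_ifle (fun hle' => ?_)
        (fun hlt => Prog.meets_nop (hskip ?_))) (fun hlt => Prog.meets_nop (hskip ?_))
      · refine Prog.Meets.mono (augmentProg_meets ⟨u, hu⟩ h4) ?_
        rintro M₅ k₅ ⟨hf₅, hy₅⟩
        refine ⟨hM₄.of_eq (hf₅ 0 (by decide) (by decide)) (hf₅ 1 (by decide) (by decide)), ?_, ?_⟩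
        · rw [hf₅ 3 (by decide) (by decide), h3']
        · rw [foldl_take_finRange_succ _ _ hu, ← hy₂, rankedStep, if_pos, hy₅]
          simp only [Expr.eval_var, h3', hr] at hle hle'
          omega
      · simp only [Expr.eval_var, h3', hr] at hlt
        omega
      · simp only [Expr.eval_var, h3', hr] at hlt
        omega
    · rintro M' _ ⟨hM', _, hy'⟩
      refine ⟨hM', ?_⟩
      rw [List.range_succ, List.foldl_append, ← hy, hy', List.take_of_length_le (by simp)]
      rfl
  · rintro M' _ ⟨_, hy⟩
    rw [hy, greedyAlong_greedyOrder]

theorem holdsLinear_linInput (w : Fin n → ℤ) : HoldsLinear w (linInput w) :=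
  ⟨arrayOf_apply ![(n : ℤ)] 0, arrayOf_apply w⟩

theorem linOutput_greedyProg (S : Set (Fin n → ℤ)) (w : Fin n → ℤ) :
    linOutput greedyProg S w = greedyAlong S (greedyOrder w) :=
  (greedyProg_meets (k := 0) (holdsLinear_linInput w) rfl).2

theorem exists_linTime_greedyProg_le :
    ∃ C k : ℕ, ∀ (n : ℕ) (S : Set (Fin n → ℤ)) (w : Fin n → ℤ), 0 < n →
      linTime greedyProg S w ≤ C * n ^ k := by
  obtain ⟨C, k, h⟩ := greedyProg.bound_le
  refine ⟨C, k, fun n S w hn => ?_⟩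
  have h1 := (greedyProg_meets (S := S) (k := 0) (holdsLinear_linInput w) rfl).1
  simpa [linTime] using h1.trans (h n 1 hn one_pos)

end GreedyProgram

/-! ### Enumeration of the chambers -/

section Enumeration

/-- The points of the box `[-b, b]^d`, enumerated by their digits in base `2 b + 1`. -/
def boxPoint (d b t : ℕ) : Fin d → ℤ := fun i =>
  ((t / (2 * b + 1) ^ (i : ℕ) % (2 * b + 1) : ℕ) : ℤ) - b

theorem abs_boxPoint_le (d b t : ℕ) (i : Fin d) : |boxPoint d b t i| ≤ b := by
  have := Nat.mod_lt (t / (2 * b + 1) ^ (i : ℕ)) (show 0 < 2 * b + 1 by omega)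
  unfold boxPoint
  rw [abs_le]
  omega

theorem exists_boxPoint_eq {d b : ℕ} {v : Fin d → ℤ} (hv : ∀ i, |v i| ≤ b) :
    ∃ t < (2 * b + 1) ^ d, boxPoint d b t = v := by
  have hlt : ∀ i, (v i + b).toNat < 2 * b + 1 := fun i => by
    have := abs_le.1 (hv i); omega
  -- The index t is the number whose base 2b + 1 digits are the entries of v shifted by b.
  refine ⟨finFunctionFinEquiv fun i => ⟨(v i + b).toNat, hlt i⟩, Fin.is_lt _, ?_⟩
  ext i
  have h1 := congrArg Fin.val (congrFun (finFunctionFinEquiv.symm_apply_apply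
    fun i => (⟨(v i + b).toNat, hlt i⟩ : Fin (2 * b + 1))) i)
  have h2 := abs_le.1 (hv i)
  unfold boxPoint
  change ((_ / (2 * b + 1) ^ (i : ℕ) % (2 * b + 1) : ℕ) : ℤ) - b = v i
  rw [show ((finFunctionFinEquiv fun i => (⟨(v i + b).toNat, hlt i⟩ : Fin (2 * b + 1))) : ℕ) /
    (2 * b + 1) ^ (i : ℕ) % (2 * b + 1) = (v i + b).toNat from h1]
  omega

theorem sum_digits (N m t : ℕ) : ∑ i ∈ Finset.range m, t / N ^ i % N * N ^ i = t % N ^ m := by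
  induction m with
  | zero => simp [Nat.mod_one]
  | succ m ih => rw [Finset.sum_range_succ, ih, Nat.mod_pow_succ, mul_comm (N ^ m)]

/-- A bound on the entries of suitable integer points of the chambers. -/
def chamberBound (d p : ℕ) : ℕ := d.factorial * p ^ d

/-- The point number `t` of the box is the first one in its chamber. -/
def IsRepresentative (d p t : ℕ) : Prop :=
  SameChamber p (boxPoint d (chamberBound d p) t) (boxPoint d (chamberBound d p) t) ∧
    ∀ t' < t, ¬ SameChamber p (boxPoint d (chamberBound d p) t) (boxPoint d (chamberBound d p) t')

open Classical in
/-- The representatives of the chambers among the first `t` points of the box. -/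
noncomputable def representatives (d p t : ℕ) : Finset ℕ :=
  (Finset.range t).filter (IsRepresentative d p)

/-- The number of points in the box. -/
def boxSize (d p : ℕ) : ℕ := (2 * chamberBound d p + 1) ^ d

/-- The chamber of h has a point in the box, and the point of least index in that chamber is its
representative. -/
theorem exists_representative {d p : ℕ} (hp : 0 < p) {h : Fin d → ℝ}
    (hh : IsGeneric (primitiveGenerators d p) h) :
    ∃ t ∈ representatives d p (boxSize d p),
      IsGeneric (primitiveGenerators d p) (realVec (boxPoint d (chamberBound d p) t)) ∧
      zonotopeVertex (primitiveGenerators d p) (realVec (boxPoint d (chamberBound d p) t)) =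
        zonotopeVertex (primitiveGenerators d p) h := by
  classical
  obtain ⟨z, hz, hzg, hzv⟩ := exists_small_chamber_point hp hh
  obtain ⟨t₁, ht₁, rfl⟩ := exists_boxPoint_eq hz
  have hex : ∃ t, SameChamber p (boxPoint d (chamberBound d p) t₁)
      (boxPoint d (chamberBound d p) t) := ⟨t₁, sameChamber_iff.2 ⟨hzg, hzg, rfl⟩⟩
  obtain ⟨_, h2, h3⟩ := sameChamber_iff.1 (Nat.find_spec hex)
  have hle : Nat.find hex ≤ t₁ := Nat.find_min' hex (sameChamber_iff.2 ⟨hzg, hzg, rfl⟩)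
  refine ⟨Nat.find hex, Finset.mem_filter.2 ⟨Finset.mem_range.2 (hle.trans_lt ht₁), ?_, ?_⟩, h2,
    h3.symm.trans hzv⟩
  · exact sameChamber_iff.2 ⟨h2, h2, rfl⟩
  · intro t' ht' hs
    obtain ⟨_, h4, h5⟩ := sameChamber_iff.1 hs
    exact Nat.find_min hex ht' (sameChamber_iff.2 ⟨hzg, h4, h3.trans h5⟩)

/-- Mapping a representative to its zonotope vertex is a bijection: onto because every chamber meets
the box, injective because only the first point of a chamber counts. Hence the exact number of
linear problems. -/
theorem card_representatives {d p : ℕ} (hp : 0 < p) :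
    (representatives d p (boxSize d p)).card = numVertices d p := by
  classical
  set φ : ℕ → Fin d → ℝ := fun t =>
    zonotopeVertex (primitiveGenerators d p) (realVec (boxPoint d (chamberBound d p) t)) with hφ
  have himage : vertices (primitiveZonotope d p) =
      φ '' (representatives d p (boxSize d p) : Set ℕ) := by
    ext v
    constructor
    · intro hv
      obtain ⟨h, hh, rfl⟩ := exists_generic_of_mem_vertices
        (fun g hg => ne_zero_of_mem_primitiveGenerators hg) hv
      obtain ⟨t, ht, _, h2⟩ := exists_representative hp hh
      exact ⟨t, ht, h2⟩
    · rintro ⟨t, ht, rfl⟩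
      exact (sameChamber_iff.1 (Finset.mem_filter.1 ht).2.1).1.mem_vertices
  rw [numVertices, himage, Set.InjOn.ncard_image, Set.ncard_coe_finset]
  intro t ht t' ht' heq
  have h1 := (Finset.mem_filter.1 ht).2
  have h2 := (Finset.mem_filter.1 ht').2
  have g1 := (sameChamber_iff.1 h1.1).1
  have g2 := (sameChamber_iff.1 h2.1).1
  rcases lt_trichotomy t t' with h | h | h
  · exact absurd (sameChamber_iff.2 ⟨g2, g1, heq.symm⟩) (h2.2 t h)
  · exact h
  · exact absurd (sameChamber_iff.2 ⟨g1, g2, heq⟩) (h1.2 t' h)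

/-- A vertex of the projection is found by the linear problem of some representative. -/
theorem exists_representative_of_vertex {d n p : ℕ} (hp : 0 < p) {S : Set (Fin n → ℤ)}
    (hS : IsMatroid S) {W : Matrix (Fin d) (Fin n) ℤ} (hW : IsBoundedUtility p W)
    {u : Fin d → ℝ} (hu : u ∈ vertices (projPolytope W S)) :
    ∃ t ∈ representatives d p (boxSize d p), ∀ x,
      SolvesLinear S (Matrix.vecMul (boxPoint d (chamberBound d p) t) W) x →
        realVec (W.mulVec x) = u := by
  obtain ⟨h, hg, hh⟩ := exists_generic_mem_normalCone p hS W hu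
  obtain ⟨t, ht, htg, hteq⟩ := exists_representative hp hg
  refine ⟨t, ht, fun x hx => ?_⟩
  obtain ⟨u', hu', hsub⟩ := exists_vertex_normalCone_subset hS hW hg
  have hu'u : u' = u := normalCone_inter_unique hu'.1 hu.1 (hsub hg.mem_normalCone) hh
  subst hu'u
  -- The representative selects the same zonotope vertex as h, so it lies in the normal cone at u,
  -- and a basis not projecting to u is worse than one that does.
  have hmem := hsub (by rw [← hteq]; exact htg.mem_normalCone)
  by_contra hne
  have h1 := hmem _ (subset_convexHull ℝ _ ⟨x, hx.1, rfl⟩) hne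
  obtain ⟨y, hy, hyu⟩ := vertices_convexHull_subset _ hu'
  rw [← hyu] at h1
  simp only [dotProduct_realVec, Int.cast_lt, Matrix.dotProduct_mulVec] at h1
  exact absurd (hx.2 y hy) (not_le.2 h1)

/-- The best of the solutions found for the representatives solves the multicriteria problem. -/
theorem solvesMulticriteria_of_best {d n p : ℕ} (hp : 0 < p) {S : Set (Fin n → ℤ)}
    (hS : IsMatroid S) {W : Matrix (Fin d) (Fin n) ℤ} (hW : IsBoundedUtility p W)
    {f : (Fin d → ℝ) → ℝ} (hf : ConvexOn ℝ Set.univ f) {X : ℕ → Fin n → ℤ}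
    (hX : ∀ t, SolvesLinear S (Matrix.vecMul (boxPoint d (chamberBound d p) t) W) (X t)) {t₀ : ℕ}
    (ht₀ : ∀ t ∈ representatives d p (boxSize d p),
      f (realVec (W.mulVec (X t))) ≤ f (realVec (W.mulVec (X t₀)))) :
    SolvesMulticriteria S W f (X t₀) := by
  refine ⟨(hX t₀).1, fun y hy => ?_⟩
  obtain ⟨u, hu, hle⟩ := exists_vertex_ge (hS.finite_image W) hf
    (subset_convexHull ℝ _ ⟨y, hy, rfl⟩)
  obtain ⟨t, ht, hut⟩ := exists_representative_of_vertex hp hS hW hu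
  rw [← hut _ (hX t)] at hle
  exact hle.trans (ht₀ t ht)

/-- This ensures that the algorithm ends with an incumbent. -/
theorem representatives_nonempty {d n p : ℕ} (hp : 0 < p) {S : Set (Fin n → ℤ)}
    (hS : IsMatroid S) {W : Matrix (Fin d) (Fin n) ℤ} (hW : IsBoundedUtility p W) :
    (representatives d p (boxSize d p)).Nonempty := by
  obtain ⟨u, hu⟩ := vertices_nonempty (hS.finite_image W) (hS.nonempty.image _)
  obtain ⟨t, ht, _⟩ := exists_representative_of_vertex hp hS hW hu
  exact ⟨t, ht⟩

end Enumeration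

/-! ### Multicriteria optimization as a program -/

section MultiProgram

/-- The arrays of the three groups of loop counters. -/
def ctr (r i : ℕ) : ℕ := 20 + (3 * i + r)

/-- The groups are residue classes modulo 3, shifted beyond 20, so they collide neither with each
other nor with the arrays of fixed purpose, all below 20. -/
theorem ctr_injective (r : ℕ) : Function.Injective (ctr r) := fun i j h => by
  unfold ctr at h; omega

theorem ctr_ne_of_lt {r i b : ℕ} (hb : b < 20) : b ≠ ctr r i := by unfold ctr; omega

theorem ctr_zero_ne_one (i j : ℕ) : ctr 0 i ≠ ctr 1 j := by unfold ctr; omega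

theorem ctr_zero_ne_two (i j : ℕ) : ctr 0 i ≠ ctr 2 j := by unfold ctr; omega

theorem ctr_one_ne_two (i j : ℕ) : ctr 1 i ≠ ctr 2 j := by unfold ctr; omega

variable {d n p L q : ℕ} {O : MultiQuery → Mem → Mem} {c s : MultiQuery → Mem → ℕ} {M : Mem}
  {k : ℕ}

/-- The counters of group `r` hold the digits of `t` in base `2 b + 1`. -/
def HoldsPoint (d r b t : ℕ) (M : Mem) : Prop :=
  ∀ i < d, M (ctr r i) 0 = ((t / (2 * b + 1) ^ i % (2 * b + 1) : ℕ) : ℤ)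

theorem HoldsPoint.of_eq {r b t : ℕ} {M' : Mem} (h : HoldsPoint d r b t M)
    (h' : ∀ i, M' (ctr r i) = M (ctr r i)) : HoldsPoint d r b t M' := fun i hi => by
  rw [h', h i hi]

/-- The expression for a coordinate of the point held by the counters of group `r`. -/
def coordExpr (r : ℕ) (b : Expr) (i : ℕ) : Expr := .sub (.var (ctr r i)) b

theorem eval_coordExpr {r b t : ℕ} {e : Expr} (he : e.eval M = b) (h : HoldsPoint d r b t M)
    (i : Fin d) : (coordExpr r e i).eval M = boxPoint d b t i := by
  simp [coordExpr, he, h i i.2, boxPoint]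

/-- The expression for a scalar product. -/
def dotExpr (d : ℕ) (f g : ℕ → Expr) : Expr := .sum (fun i => .mul (f i) (g i)) d

theorem eval_dotExpr {f g : ℕ → Expr} {u v : Fin d → ℤ} (hf : ∀ i : Fin d, (f i).eval M = u i)
    (hg : ∀ i : Fin d, (g i).eval M = v i) : (dotExpr d f g).eval M = dotProduct u v := by
  simp [dotExpr, Finset.sum_range, hf, hg, dotProduct]

/-- The expression for the size `n` of the ground set. -/
def numExpr : Expr := .cell 0 (.const 0)

/-- The expression for the bound `p` on the utilities. -/
def boundExpr : Expr := .cell 0 (.const 1)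

/-- The expression for `chamberBound d p`. -/
def chamberExpr (d : ℕ) : Expr := .mul (.const d.factorial) (.pow boundExpr d)

theorem eval_chamberExpr (hM : M 0 1 = p) : (chamberExpr d).eval M = chamberBound d p := by
  simp [chamberExpr, boundExpr, hM, chamberBound]

/-- The expression for the number of points on a side of the box of half-width `b`. -/
def sideExpr (b : Expr) : Expr := .add (.mul (.const 2) b) (.const 1)

theorem eval_sideExpr {b : ℕ} {e : Expr} (he : e.eval M = b) :
    (sideExpr e).eval M = ((2 * b + 1 : ℕ) : ℤ) := by
  simp [sideExpr, he]

/-- The expression for the index of the point held by the counters of group `r`. -/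
def indexExpr (d r : ℕ) : Expr :=
  .sum (fun i => .mul (.var (ctr r i)) (.pow (sideExpr (chamberExpr d)) i)) d

/-- Points are stored as digits only; the index is recovered to compare two points in the
enumeration order. -/
theorem eval_indexExpr {r t : ℕ} (hM : M 0 1 = p) (h : HoldsPoint d r (chamberBound d p) t M)
    (ht : t < boxSize d p) : (indexExpr d r).eval M = t := by
  have h1 := sum_digits (2 * chamberBound d p + 1) d t
  rw [Nat.mod_eq_of_lt (show t < (2 * chamberBound d p + 1) ^ d from ht)] at h1
  rw [indexExpr, Expr.eval_sum]
  conv_rhs => rw [← h1]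
  rw [Nat.cast_sum]
  refine Finset.sum_congr rfl fun i hi => ?_
  simp only [Expr.eval, Expr.eval_var, Expr.eval_pow, h i (Finset.mem_range.1 hi),
    eval_sideExpr (eval_chamberExpr (d := d) hM)]
  push_cast
  rfl

/-- Test whether the points in the first two groups of counters lie in the same chamber. -/
def sameChamberProg (d : ℕ) : Prog MultiQuery :=
  .seq (.assign 10 (.const 0) (.const 1)) <|
    .nest (ctr 2) (sideExpr boundExpr)
      (.ifle (dotExpr d (coordExpr 2 boundExpr) (coordExpr 2 boundExpr)) (.const 0) .nop <|
        .ifle (.const 1)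
          (.mul (dotExpr d (coordExpr 0 (chamberExpr d)) (coordExpr 2 boundExpr))
            (dotExpr d (coordExpr 1 (chamberExpr d)) (coordExpr 2 boundExpr))) .nop <|
          .assign 10 (.const 0) (.const 0)) d

/-- Cell `0` of array `10` stays 1 until some nonzero v of sup-norm at most p yields a product that
is not positive. The zero vector is recognized by `v · v ≤ 0` and skipped. -/
theorem sameChamberProg_meets {t t' : ℕ} (hL : 2 * p + 1 ≤ L) (hM : M 0 1 = p)
    (h0 : HoldsPoint d 0 (chamberBound d p) t M) (h1 : HoldsPoint d 1 (chamberBound d p) t' M) :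
    (sameChamberProg d).Meets O c s L q M k fun M' k' => k' = k ∧
      (∀ b, b ≠ 10 → (∀ i, b ≠ ctr 2 i) → M' b = M b) ∧
      M' 10 0 = truth (SameChamber p (boxPoint d (chamberBound d p) t)
        (boxPoint d (chamberBound d p) t')) := by
  set h := boxPoint d (chamberBound d p) t
  set h' := boxPoint d (chamberBound d p) t'
  let good : (Fin d → ℤ) → Prop := fun v => v ≠ 0 → 0 < dotProduct h v * dotProduct h' v
  have hparam : ∀ M' : Mem, (∀ b, b ≠ 10 → (∀ i, b ≠ ctr 2 i) → M' b = M b) → M' 0 1 = p :=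
    fun M' hf => by rw [hf 0 (by decide) fun i => ctr_ne_of_lt (by decide), hM]
  refine Prog.meets_seq (Prog.meets_assign (Prog.meets_nest (ctr_injective 2) hL
    (fun u M' k' => k' = k ∧ (∀ b, b ≠ 10 → (∀ i, b ≠ ctr 2 i) → M' b = M b) ∧
      M' 10 0 = truth (∀ u' < u, good (boxPoint d p u'))) ?_ ?_ ?_ ?_ ?_))
  · rintro u M' k' ⟨_, hf, _⟩
    exact eval_sideExpr (by simp [boundExpr, hparam M' hf])
  · rintro u M' k' ⟨hk, hf, hr⟩ i _ z
    refine ⟨hk, fun b hb hb' => by rw [Mem.put_of_ne _ _ _ (hb' i), hf b hb hb'], ?_⟩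
    rw [Mem.put_of_ne _ _ _ (ctr_ne_of_lt (by decide)), hr]
  · refine ⟨rfl, fun b hb _ => Mem.put_of_ne _ _ _ hb, ?_⟩
    rw [truth_eq_one (by simp)]
    simp [Mem.put_apply]
  · rintro u hu M' k' ⟨hk, hf, hr⟩ hdig
    have hp' := hparam M' hf
    have eb : boundExpr.eval M' = p := by simp [boundExpr, hp']
    have ec : (chamberExpr d).eval M' = chamberBound d p := eval_chamberExpr hp'
    have hv := eval_coordExpr eb (show HoldsPoint d 2 p u M' from hdig)
    have hh := eval_coordExpr ec (h0.of_eq (M' := M') fun i => hf _ (by unfold ctr; omega)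
      fun j => ctr_zero_ne_two i j)
    have hh' := eval_coordExpr ec (h1.of_eq (M' := M') fun i => hf _ (by unfold ctr; omega)
      fun j => ctr_one_ne_two i j)
    have hsucc : (∀ u' < u + 1, good (boxPoint d p u')) ↔
        (∀ u' < u, good (boxPoint d p u')) ∧ good (boxPoint d p u) := by
      constructor
      · intro H; exact ⟨fun u' hu' => H u' (by omega), H u (by omega)⟩
      · rintro ⟨H, H'⟩ u' hu'
        rcases (Nat.lt_succ_iff.1 hu').eq_or_lt with rfl | h
        · exact H'
        · exact H u' h
    have hgood : good (boxPoint d p u) → (k' = k ∧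
        (∀ b, b ≠ 10 → (∀ i, b ≠ ctr 2 i) → M' b = M b) ∧
        M' 10 0 = truth (∀ u' < u + 1, good (boxPoint d p u'))) ∧
        ∀ i < d, M' (ctr 2 i) 0 = M' (ctr 2 i) 0 := fun hg =>
      ⟨⟨hk, hf, by rw [hr]; congr 1; rw [hsucc]; exact propext ⟨fun H => ⟨H, hg⟩, fun H => H.1⟩⟩,
        fun _ _ => rfl⟩
    have hsq := eval_dotExpr hv hv
    have hself : 0 ≤ dotProduct (boxPoint d p u) (boxPoint d p u) := by
      unfold dotProduct; exact Finset.sum_nonneg fun i _ => mul_self_nonneg _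
    refine Prog.meets_ifle (fun hle => Prog.meets_nop (hgood ?_)) (fun hlt => Prog.meets_ifle
      (fun hle => Prog.meets_nop (hgood ?_)) (fun hlt' => Prog.meets_assign ?_))
    · intro hne
      rw [hsq] at hle
      exact absurd (dotProduct_self_eq_zero.1 (le_antisymm hle hself)) hne
    · intro _
      rw [Expr.eval, Expr.eval, eval_dotExpr hh hv, eval_dotExpr hh' hv] at hle
      exact hle
    · rw [Expr.eval, Expr.eval, eval_dotExpr hh hv, eval_dotExpr hh' hv] at hlt'
      rw [hsq] at hlt
      have hbad : ¬ good (boxPoint d p u) := fun hg => by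
        exact absurd (hg fun h0 => by simp [h0] at hlt) (not_lt.2 (Int.lt_add_one_iff.1 hlt'))
      refine ⟨⟨hk, fun b hb hb' => by rw [Mem.put_of_ne _ _ _ hb, hf b hb hb'], ?_⟩,
        fun i _ => by rw [Mem.put_of_ne _ _ _ (by unfold ctr; omega)]⟩
      rw [truth_eq_zero fun H => hbad (hsucc.1 H).2]
      simp [Mem.put_apply]
  · rintro M' k' ⟨hk, hf, hr⟩
    refine ⟨hk, hf, ?_⟩
    rw [hr]
    congr 1
    refine propext ⟨fun H v hv hv0 => ?_, fun H u _ => H _ (abs_boxPoint_le d p u)⟩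
    obtain ⟨u, hu, rfl⟩ := exists_boxPoint_eq hv
    exact H u hu hv0

/-- Count the points, up to the point in the first group of counters, that lie in the same chamber
as this point. -/
def countProg (d : ℕ) : Prog MultiQuery :=
  .seq (.assign 9 (.const 0) (.const 0)) <|
    .nest (ctr 1) (sideExpr (chamberExpr d))
      (.seq (sameChamberProg d) <|
        .ifle (indexExpr d 1) (indexExpr d 0)
          (.assign 9 (.const 0) (.add (.var 9) (.var 10))) .nop) d

-- The loops run over the whole box, as their lengths are fixed, and the comparison of indices
-- discards the points after t.
open Classical in
theorem countProg_meets {t : ℕ} (hL : 2 * p + 1 ≤ L) (hL' : 2 * chamberBound d p + 1 ≤ L)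
    (hM : M 0 1 = p) (h0 : HoldsPoint d 0 (chamberBound d p) t M) (ht : t < boxSize d p) :
    (countProg d).Meets O c s L q M k fun M' k' => k' = k ∧
      (∀ b < 9, M' b = M b) ∧ (∀ i, M' (ctr 0 i) = M (ctr 0 i)) ∧
      M' 9 0 = (((Finset.range (boxSize d p)).filter fun t' => t' ≤ t ∧
        SameChamber p (boxPoint d (chamberBound d p) t)
          (boxPoint d (chamberBound d p) t')).card : ℕ) := by
  refine Prog.meets_seq (Prog.meets_assign (Prog.meets_nest (ctr_injective 1) hL'
    (fun u M' k' => k' = k ∧ (∀ b < 9, M' b = M b) ∧ (∀ i, M' (ctr 0 i) = M (ctr 0 i)) ∧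
      M' 9 0 = (((Finset.range u).filter fun t' => t' ≤ t ∧
        SameChamber p (boxPoint d (chamberBound d p) t)
          (boxPoint d (chamberBound d p) t')).card : ℕ)) ?_ ?_ ?_ ?_ ?_))
  · rintro u M' k' ⟨_, hf, _⟩
    exact eval_sideExpr (eval_chamberExpr (by rw [hf 0 (by decide), hM]))
  · rintro u M' k' ⟨hk, hf, hf', hr⟩ i _ z
    refine ⟨hk, fun b hb => by rw [Mem.put_of_ne _ _ _ (ctr_ne_of_lt (by omega)), hf b hb],
      fun j => by rw [Mem.put_of_ne _ _ _ (ctr_zero_ne_one j i), hf'], ?_⟩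
    rw [Mem.put_of_ne _ _ _ (ctr_ne_of_lt (by decide)), hr]
  · exact ⟨rfl, fun b hb => Mem.put_of_ne _ _ _ (by omega),
      fun i => Mem.put_of_ne _ _ _ (by unfold ctr; omega), by simp [Mem.put_apply]⟩
  · rintro u hu M' k' ⟨hk, hf, hf', hr⟩ hdig
    have hp' : M' 0 1 = p := by rw [hf 0 (by decide), hM]
    refine Prog.meets_seq (Prog.Meets.mono (sameChamberProg_meets hL hp' (h0.of_eq hf') hdig) ?_)
    rintro M₁ k₁ ⟨rfl, hf₁, hr₁⟩
    have hb₁ : ∀ b < 10, M₁ b = M' b := fun b hb =>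
      hf₁ b (by omega) fun i => ctr_ne_of_lt (by omega)
    have hc₀ : ∀ i, M₁ (ctr 0 i) = M' (ctr 0 i) := fun i =>
      hf₁ _ (by unfold ctr; omega) fun j => ctr_zero_ne_two i j
    have hc₁ : ∀ i, M₁ (ctr 1 i) = M' (ctr 1 i) := fun i =>
      hf₁ _ (by unfold ctr; omega) fun j => ctr_one_ne_two i j
    have hp₁ : M₁ 0 1 = p := by rw [hb₁ 0 (by decide), hp']
    have e0 : (indexExpr d 0).eval M₁ = t :=
      eval_indexExpr hp₁ ((h0.of_eq hf').of_eq hc₀) ht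
    have e1 : (indexExpr d 1).eval M₁ = u :=
      eval_indexExpr hp₁ (HoldsPoint.of_eq (M := M') hdig hc₁) hu
    refine Prog.meets_ifle (fun hle => Prog.meets_assign ?_) (fun hlt => Prog.meets_nop ?_)
    · rw [e0, e1] at hle
      refine ⟨⟨hk, fun b hb => by rw [Mem.put_of_ne _ _ _ (by omega), hb₁ b (by omega), hf b hb],
        fun i => by rw [Mem.put_of_ne _ _ _ (by unfold ctr; omega), hc₀, hf'], ?_⟩,
        fun i _ => by rw [Mem.put_of_ne _ _ _ (by unfold ctr; omega), hc₁]⟩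
      rw [Finset.range_add_one, Finset.filter_insert]
      simp only [Expr.eval, Expr.eval_var, Mem.put_apply, and_self, if_true, hr₁]
      rw [hb₁ 9 (by decide), hr]
      by_cases hs : SameChamber p (boxPoint d (chamberBound d p) t)
          (boxPoint d (chamberBound d p) u)
      · rw [truth_eq_one hs, if_pos ⟨by omega, hs⟩, Finset.card_insert_of_notMem (by simp)]
        simp
      · rw [truth_eq_zero hs, if_neg fun h => hs h.2]
        simp
    · rw [e0, e1] at hlt
      refine ⟨⟨hk, fun b hb => by rw [hb₁ b (by omega), hf b hb],
        fun i => by rw [hc₀, hf'], ?_⟩, fun i _ => by rw [hc₁]⟩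
      rw [Finset.range_add_one, Finset.filter_insert, if_neg (by omega), hb₁ 9 (by decide), hr]
  · intro M' k' h
    exact h

-- A generic t counts itself, so the count is 1 exactly when no earlier point shares its chamber;
-- for a t that is not generic the count is 0.
open Classical in
theorem card_eq_one_iff_isRepresentative {t : ℕ} (ht : t < boxSize d p) :
    ((Finset.range (boxSize d p)).filter fun t' => t' ≤ t ∧
      SameChamber p (boxPoint d (chamberBound d p) t)
        (boxPoint d (chamberBound d p) t')).card = 1 ↔ IsRepresentative d p t := by
  rw [Finset.card_eq_one]
  constructor
  · rintro ⟨a, ha⟩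
    have hself : SameChamber p (boxPoint d (chamberBound d p) t)
        (boxPoint d (chamberBound d p) t) := by
      have h1 : a ∈ ({a} : Finset ℕ) := by simp
      rw [← ha, Finset.mem_filter] at h1
      have := (sameChamber_iff.1 h1.2.2).1
      exact sameChamber_iff.2 ⟨this, this, rfl⟩
    have hmem : ∀ t', t' ≤ t → SameChamber p (boxPoint d (chamberBound d p) t)
        (boxPoint d (chamberBound d p) t') → t' = a := fun t' h h' => by
      rw [← Finset.mem_singleton, ← ha, Finset.mem_filter, Finset.mem_range]
      exact ⟨by omega, h, h'⟩
    refine ⟨hself, fun t' ht' hs => ?_⟩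
    have h1 := hmem t le_rfl hself
    have h2 := hmem t' ht'.le hs
    omega
  · rintro ⟨hself, hmin⟩
    refine ⟨t, ?_⟩
    ext t'
    rw [Finset.mem_filter, Finset.mem_singleton, Finset.mem_range]
    constructor
    · rintro ⟨_, h1, h2⟩
      rcases h1.eq_or_lt with h | h
      · exact h
      · exact absurd h2 (hmin t' h)
    · rintro rfl
      exact ⟨ht, le_rfl, hself⟩

end MultiProgram

/-! ### Solving the linear problems and keeping the best solution -/

section MultiProgram

variable {d n p L q : ℕ} {O : MultiQuery → Mem → Mem} {c s : MultiQuery → Mem → ℕ} {M : Mem}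
  {k : ℕ}

/-- The memory holds the multicriteria problem with utility matrix `W`. -/
def HoldsMulti (p : ℕ) (W : Matrix (Fin d) (Fin n) ℤ) (M : Mem) : Prop :=
  M 0 0 = n ∧ M 0 1 = p ∧ ∀ (i : Fin d) (j : Fin n), M 1 ((i : ℤ) * n + j) = W i j

theorem HoldsMulti.of_eq {W : Matrix (Fin d) (Fin n) ℤ} {M' : Mem} (h : HoldsMulti p W M)
    (h0 : M' 0 = M 0) (h1 : M' 1 = M 1) : HoldsMulti p W M' := by
  unfold HoldsMulti at h ⊢
  rwa [h0, h1]

/-- A loop that writes the value of `e` into cell `t` of array `a` in round `t`. -/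
def fillProg (v : ℕ) (N : Expr) (a : ℕ) (e : Expr) : Prog MultiQuery :=
  .loop v N (.assign a (.var v) e)

/-- The expression only has to evaluate correctly in memories that differ from M in the target and
the counter, which is all that the loop changes. -/
theorem fillProg_meets {v a m : ℕ} {N e : Expr} (hva : v ≠ a) (hN : N.eval M = m) (hL : m ≤ L)
    (x : Fin m → ℤ)
    (he : ∀ M' : Mem, (∀ b, b ≠ a → b ≠ v → M' b = M b) → ∀ j : Fin m, M' v 0 = j →
      e.eval M' = x j) :
    (fillProg v N a e).Meets O c s L q M k fun M' k' => k' = k ∧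
      (∀ b, b ≠ a → b ≠ v → M' b = M b) ∧ M'.vec m a = x := by
  refine Prog.meets_loop hN hL (fun t M' k' => k' = k ∧ (∀ b, b ≠ a → b ≠ v → M' b = M b) ∧
    ∀ j : Fin m, (j : ℕ) < t → M' a j = x j) ?_ ?_ ?_
  · exact ⟨rfl, fun _ _ _ => rfl, by simp⟩
  · rintro t ht M' k' ⟨hk, hf, hx⟩
    have hf' : ∀ b, b ≠ a → b ≠ v → (M'.put v 0 t) b = M b := fun b h1 h2 => by
      rw [Mem.put_of_ne _ _ _ h2, hf b h1 h2]
    have hv : (M'.put v 0 t) v 0 = t := by simp [Mem.put_apply]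
    refine Prog.meets_assign ⟨hk, fun b h1 h2 => by rw [Mem.put_of_ne _ _ _ h1, hf' b h1 h2], ?_⟩
    intro j hj
    rw [he _ hf' ⟨t, ht⟩ hv, Expr.eval_var, hv, Mem.put_apply]
    by_cases hjt : (j : ℕ) = t
    · subst hjt; simp
    · have : ¬ ((j : ℤ) = t) := by exact_mod_cast hjt
      rw [if_neg (by simp [this]), Mem.put_of_ne _ _ _ hva.symm]
      exact hx j (by omega)
  · rintro M' k' ⟨hk, hf, hx⟩
    exact ⟨hk, hf, funext fun j => hx j j.2⟩

/-- The expression for the entry of the utility matrix in row `i` and column `j`. -/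
def entryExpr (i j : Expr) : Expr := .cell 1 (.add (.mul i numExpr) j)

theorem eval_entryExpr {W : Matrix (Fin d) (Fin n) ℤ} (hM : HoldsMulti p W M) {e e' : Expr}
    {i : Fin d} {j : Fin n} (he : e.eval M = i) (he' : e'.eval M = j) :
    (entryExpr e e').eval M = W i j := by
  simp [entryExpr, numExpr, he, he', hM.1, hM.2.2]

/-- Write the utility vector `h W`, where `h` is the point in the first group of counters, into
array `3`. -/
def utilityProg (d : ℕ) : Prog MultiQuery :=
  fillProg 11 numExpr 3
    (dotExpr d (coordExpr 0 (chamberExpr d)) fun i => entryExpr (.const i) (.var 11))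

theorem utilityProg_meets {W : Matrix (Fin d) (Fin n) ℤ} {t : ℕ} (hM : HoldsMulti p W M)
    (hL : n ≤ L) (h0 : HoldsPoint d 0 (chamberBound d p) t M) :
    (utilityProg d).Meets O c s L q M k fun M' k' => k' = k ∧
      (∀ b, b ≠ 3 → b ≠ 11 → M' b = M b) ∧
      M'.vec n 3 = Matrix.vecMul (boxPoint d (chamberBound d p) t) W := by
  refine fillProg_meets (by decide) (by simp [numExpr, hM.1]) hL _ fun M' hf j hj => ?_
  have hM' : HoldsMulti p W M' :=
    hM.of_eq (hf 0 (by decide) (by decide)) (hf 1 (by decide) (by decide))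
  exact eval_dotExpr
    (eval_coordExpr (eval_chamberExpr hM'.2.1)
      (h0.of_eq fun i => hf _ (by unfold ctr; omega) (by unfold ctr; omega)))
    fun i => eval_entryExpr hM' rfl hj

/-- Write the vector `W x`, where `x` is in array `4`, into array `5`. -/
def valueProg (d : ℕ) : Prog MultiQuery :=
  .loop 12 (.const d) <|
    .seq (.assign 5 (.var 12) (.const 0)) <|
      .loop 11 numExpr <| .assign 5 (.var 12) <|
        .add (.cell 5 (.var 12)) (.mul (entryExpr (.var 12) (.var 11)) (.cell 4 (.var 11)))

theorem valueProg_meets {W : Matrix (Fin d) (Fin n) ℤ} (hM : HoldsMulti p W M) (hL : n ≤ L)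
    (hL' : d ≤ L) :
    (valueProg d).Meets O c s L q M k fun M' k' => k' = k ∧
      (∀ b, b ≠ 5 → b ≠ 11 → b ≠ 12 → M' b = M b) ∧
      M'.vec d 5 = W.mulVec (M.vec n 4) := by
  refine Prog.meets_loop (N := d) rfl hL' (fun i M' k' => k' = k ∧
    (∀ b, b ≠ 5 → b ≠ 11 → b ≠ 12 → M' b = M b) ∧
    ∀ l : Fin d, (l : ℕ) < i → M' 5 l = W.mulVec (M.vec n 4) l) ?_ ?_ ?_
  · exact ⟨rfl, fun _ _ _ _ => rfl, by simp⟩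
  · rintro i hi M₁ k₁ ⟨hk₁, hf₁, hx₁⟩
    have hM₁ : M₁ 0 0 = n := by rw [hf₁ 0 (by decide) (by decide) (by decide), hM.1]
    refine Prog.meets_seq (Prog.meets_assign ?_)
    refine Prog.meets_loop (N := n) (by simp [numExpr, Mem.put_apply, hM₁]) hL
      (fun t M' k' => k' = k ∧ (∀ b, b ≠ 5 → b ≠ 11 → b ≠ 12 → M' b = M b) ∧ M' 12 0 = i ∧
        (∀ l : Fin d, (l : ℕ) < i → M' 5 l = W.mulVec (M.vec n 4) l) ∧
        M' 5 i = ∑ j ∈ Finset.univ.filter fun j : Fin n => (j : ℕ) < t,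
          W ⟨i, hi⟩ j * M.vec n 4 j) ?_ ?_ ?_
    · refine ⟨hk₁, fun b h5 h11 h12 => by
        rw [Mem.put_of_ne _ _ _ h5, Mem.put_of_ne _ _ _ h12, hf₁ b h5 h11 h12],
        by simp [Mem.put_apply], fun l hl => ?_, by simp [Mem.put_apply]⟩
      have : ¬ ((l : ℤ) = i) := by omega
      simp [Mem.put_apply, this, hx₁ l hl]
    · rintro t ht M₂ k₂ ⟨hk₂, hf₂, h12, hx₂, hy₂⟩
      have hM₂ : HoldsMulti p W (M₂.put 11 0 t) := hM.of_eq
        (by rw [Mem.put_of_ne _ _ _ (by decide), hf₂ 0 (by decide) (by decide) (by decide)])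
        (by rw [Mem.put_of_ne _ _ _ (by decide), hf₂ 1 (by decide) (by decide) (by decide)])
      have h12' : (Expr.var 12).eval (M₂.put 11 0 t) = ((⟨i, hi⟩ : Fin d) : ℕ) := by
        simp [Mem.put_apply, h12]
      have h11' : (Expr.var 11).eval (M₂.put 11 0 t) = ((⟨t, ht⟩ : Fin n) : ℕ) := by
        simp [Mem.put_apply]
      have hx4 : (Expr.cell 4 (.var 11)).eval (M₂.put 11 0 t) = M.vec n 4 ⟨t, ht⟩ := by
        rw [Expr.eval, h11', Mem.put_of_ne _ _ _ (by decide),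
          hf₂ 4 (by decide) (by decide) (by decide)]
        rfl
      have hy5 : (Expr.cell 5 (.var 12)).eval (M₂.put 11 0 t) = M₂ 5 i := by
        rw [Expr.eval, h12', Mem.put_of_ne _ _ _ (by decide)]
      refine Prog.meets_assign ⟨hk₂, fun b h5 h11 h12 => by
        rw [Mem.put_of_ne _ _ _ h5, Mem.put_of_ne _ _ _ h11, hf₂ b h5 h11 h12],
        by simpa [Mem.put_apply] using h12, fun l hl => ?_, ?_⟩
      · have : ¬ ((l : ℤ) = i) := by omega
        rw [h12', Mem.put_apply, if_neg fun h => this h.2, Mem.put_of_ne _ _ _ (by decide),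
          hx₂ l hl]
      · have hfilter : (Finset.univ.filter fun j : Fin n => (j : ℕ) < t + 1) =
            insert ⟨t, ht⟩ (Finset.univ.filter fun j : Fin n => (j : ℕ) < t) := by
          ext j
          simp only [Finset.mem_filter, Finset.mem_univ, true_and, Finset.mem_insert, Fin.ext_iff]
          omega
        rw [hfilter, Finset.sum_insert (by simp), ← hy₂, h12', Mem.put_apply, if_pos ⟨rfl, rfl⟩]
        change (Expr.cell 5 (.var 12)).eval _ + (entryExpr (.var 12) (.var 11)).eval _ *
          (Expr.cell 4 (.var 11)).eval _ = _
        rw [hy5, hx4, eval_entryExpr hM₂ h12' h11', add_comm]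
    · rintro M' k' ⟨hk', hf', _, hx', hy'⟩
      refine ⟨hk', hf', fun l hl => ?_⟩
      rcases (Nat.lt_succ_iff.1 hl).eq_or_lt with h | h
      · have hl' : l = ⟨i, hi⟩ := Fin.ext h
        subst hl'
        rw [hy']
        simp [Matrix.mulVec, dotProduct]
      · exact hx' l h
  · rintro M' k' ⟨hk, hf, hx⟩
    exact ⟨hk, hf, funext fun l => hx l l.2⟩

/-- Replace the incumbent solution, in array `2`, and its value, in array `6`, by the solution in
array `4` and its value, in array `5`. -/
def updateProg (d : ℕ) : Prog MultiQuery :=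
  .seq (.assign 8 (.const 0) (.const 1)) <|
    .seq (fillProg 11 numExpr 2 (.cell 4 (.var 11)))
      (fillProg 12 (.const d) 6 (.cell 5 (.var 12)))

theorem updateProg_meets {W : Matrix (Fin d) (Fin n) ℤ} (hM : HoldsMulti p W M) (hL : n ≤ L)
    (hL' : d ≤ L) :
    (updateProg d).Meets O c s L q M k fun M' k' => k' = k ∧
      (∀ b, b ≠ 2 → b ≠ 6 → b ≠ 8 → b ≠ 11 → b ≠ 12 → M' b = M b) ∧ M' 8 0 = 1 ∧
      M'.vec n 2 = M.vec n 4 ∧ M'.vec d 6 = M.vec d 5 := by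
  refine Prog.meets_seq (Prog.meets_assign (Prog.meets_seq (Prog.Meets.mono
    (fillProg_meets (m := n) (by decide) (by simp [numExpr, Mem.put_apply, hM.1]) hL (M.vec n 4)
      fun M' hf j hj => ?_) ?_)))
  · rw [Expr.eval, Expr.eval_var, hj, hf 4 (by decide) (by decide),
      Mem.put_of_ne _ _ _ (by decide)]
    rfl
  · rintro M₁ k₁ ⟨rfl, hf₁, hx₁⟩
    refine Prog.Meets.mono (fillProg_meets (m := d) (by decide) rfl hL' (M.vec d 5)
      fun M' hf j hj => ?_) ?_
    · rw [Expr.eval, Expr.eval_var, hj, hf 5 (by decide) (by decide),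
        hf₁ 5 (by decide) (by decide), Mem.put_of_ne _ _ _ (by decide)]
      rfl
    · rintro M' k' ⟨rfl, hf, hy⟩
      refine ⟨rfl, fun b h2 h6 h8 h11 h12 => ?_, ?_, ?_, hy⟩
      · rw [hf b h6 h12, hf₁ b h2 h11, Mem.put_of_ne _ _ _ h8]
      · rw [hf 8 (by decide) (by decide), hf₁ 8 (by decide) (by decide)]
        simp [Mem.put_apply]
      · rw [Mem.vec_congr (hf 2 (by decide) (by decide)), hx₁]

/-- Solve the linear problem of the point in the first group of counters, and keep the solution if
it is the first one or better than the incumbent. -/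
def processProg (d : ℕ) : Prog MultiQuery :=
  .seq (utilityProg d) <| .seq (.ask (.solve 3 4)) <| .seq (valueProg d) <|
    .seq (.ifle (.var 8) (.const 0) (.assign 7 (.const 0) (.const 1)) (.ask (.compare 6 5 7))) <|
      .ifle (.const 1) (.var 7) (updateProg d) .nop

/-- The algorithm for multicriteria optimization: it enumerates the points of a box, and processes
the first one in every chamber. -/
def multiProg (d : ℕ) : Prog MultiQuery :=
  .nest (ctr 0) (sideExpr (chamberExpr d))
    (.seq (countProg d) <|
      .ifle (.var 9) (.const 1) (.ifle (.const 1) (.var 9) (processProg d) .nop) .nop) d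

/-- The array `2` holds the best of the solutions `X t` with `t ∈ T`, and the array `6` its
value, unless `T` is empty. -/
def HoldsBest {d n : ℕ} (W : Matrix (Fin d) (Fin n) ℤ) (f : (Fin d → ℝ) → ℝ)
    (X : ℕ → Fin n → ℤ) (T : Finset ℕ) (M : Mem) : Prop :=
  (T = ∅ ∧ M 8 0 = 0) ∨ (M 8 0 = 1 ∧ ∃ t₀ ∈ T, M.vec n 2 = X t₀ ∧ M.vec d 6 = W.mulVec (X t₀) ∧
    ∀ t ∈ T, f (realVec (W.mulVec (X t))) ≤ f (realVec (W.mulVec (X t₀))))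

theorem HoldsBest.of_eq {W : Matrix (Fin d) (Fin n) ℤ} {f : (Fin d → ℝ) → ℝ}
    {X : ℕ → Fin n → ℤ} {T : Finset ℕ} {M' : Mem} (h : HoldsBest W f X T M) (h2 : M' 2 = M 2)
    (h6 : M' 6 = M 6) (h8 : M' 8 = M 8) : HoldsBest W f X T M' := by
  unfold HoldsBest at h ⊢
  rwa [h8, Mem.vec_congr h2, Mem.vec_congr h6]

variable {G : Prog LinQuery} {S : Set (Fin n → ℤ)} {W : Matrix (Fin d) (Fin n) ℤ}
  {f : (Fin d → ℝ) → ℝ}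

/-- The time charged for the queries of a multicriteria program. -/
noncomputable def queryTime (G : Prog LinQuery) (S : Set (Fin n → ℤ)) : MultiQuery → Mem → ℕ :=
  fun q M => match q with
    | .compare _ _ _ => 1
    | .solve a _ => 1 + linTime G S (M.vec n a)

/-- The number of linear problems solved by a query of a multicriteria program. -/
def querySolves : MultiQuery → Mem → ℕ :=
  fun q _ => match q with
    | .compare _ _ _ => 0
    | .solve _ _ => 1

/-- Exactly one linear problem is solved, whatever the comparison says. Cell `0` of array `8`
records whether there is an incumbent, since before the first solution there is no value to compare
with. -/
theorem processProg_meets {t : ℕ} {X : ℕ → Fin n → ℤ} {T : Finset ℕ} (hM : HoldsMulti p W M)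
    (hL : n ≤ L) (hL' : d ≤ L) (hq : ∀ w : Fin n → ℤ, 1 + linTime G S w ≤ q)
    (hX : ∀ t, X t = linOutput G S (Matrix.vecMul (boxPoint d (chamberBound d p) t) W))
    (h0 : HoldsPoint d 0 (chamberBound d p) t M) (hbest : HoldsBest W f X T M) :
    (processProg d).Meets (multiOracle G S f) (queryTime G S) querySolves L q M k fun M' k' =>
      k' = k + 1 ∧ HoldsMulti p W M' ∧ (∀ i, M' (ctr 0 i) = M (ctr 0 i)) ∧
      HoldsBest W f X (insert t T) M' := by
  have hq1 : 1 ≤ q := le_trans (by omega) (hq 0)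
  refine Prog.meets_seq (Prog.Meets.mono (utilityProg_meets hM hL h0) ?_)
  rintro M₁ k₁ ⟨rfl, hf₁, hw₁⟩
  refine Prog.meets_seq (Prog.meets_ask (hq _) ?_)
  set M₂ := multiOracle G S f (.solve 3 4) M₁ with hM₂
  have hf₂ : ∀ b, b ≠ 4 → M₂ b = M₁ b := fun b hb => by
    simp [hM₂, multiOracle, Function.update_of_ne hb]
  have hx₂ : M₂.vec n 4 = X t := by
    ext j
    simp [hM₂, multiOracle, Mem.vec, hX, ← hw₁, arrayOf_apply]
  have hHM₂ : HoldsMulti p W M₂ := hM.of_eq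
    (by rw [hf₂ 0 (by decide), hf₁ 0 (by decide) (by decide)])
    (by rw [hf₂ 1 (by decide), hf₁ 1 (by decide) (by decide)])
  refine Prog.meets_seq (Prog.Meets.mono (valueProg_meets hHM₂ hL hL') ?_)
  rintro M₃ k₃ ⟨rfl, hf₃, hy₃⟩
  rw [hx₂] at hy₃
  have hHM₃ : HoldsMulti p W M₃ := hHM₂.of_eq (hf₃ 0 (by decide) (by decide) (by decide))
    (hf₃ 1 (by decide) (by decide) (by decide))
  have hold : ∀ b, b ≠ 3 → b ≠ 4 → b ≠ 5 → b ≠ 11 → b ≠ 12 → M₃ b = M b :=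
    fun b h3 h4 h5 h11 h12 => by rw [hf₃ b h5 h11 h12, hf₂ b h4, hf₁ b h3 h11]
  have hx₃ : M₃.vec n 4 = X t := by
    rw [Mem.vec_congr (hf₃ 4 (by decide) (by decide) (by decide)), hx₂]
  have hbest₃ : HoldsBest W f X T M₃ := hbest.of_eq
    (hold 2 (by decide) (by decide) (by decide) (by decide) (by decide))
    (hold 6 (by decide) (by decide) (by decide) (by decide) (by decide))
    (hold 8 (by decide) (by decide) (by decide) (by decide) (by decide))
  have hc₃ : ∀ i, M₃ (ctr 0 i) = M (ctr 0 i) := fun i =>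
    hold _ (by unfold ctr; omega) (by unfold ctr; omega) (by unfold ctr; omega)
      (by unfold ctr; omega) (by unfold ctr; omega)
  -- Both reasons for an update, no incumbent and a better value, have by then changed only cell `0`
  -- of array `7`.
  have hupdate : ∀ z : ℤ, (∀ t' ∈ T, f (realVec (W.mulVec (X t'))) ≤ f (realVec (W.mulVec (X t)))) →
      (updateProg d).Meets (multiOracle G S f) (queryTime G S) querySolves L q (M₃.put 7 0 z)
        (k₁ + 1) fun M' k' => k' = k₁ + 1 ∧ HoldsMulti p W M' ∧
          (∀ i, M' (ctr 0 i) = M (ctr 0 i)) ∧ HoldsBest W f X (insert t T) M' := by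
    intro z hT
    have hHM : HoldsMulti p W (M₃.put 7 0 z) :=
      hHM₃.of_eq (Mem.put_of_ne _ _ _ (by decide)) (Mem.put_of_ne _ _ _ (by decide))
    refine Prog.Meets.mono (updateProg_meets hHM hL hL') ?_
    rintro M₄ k₄ ⟨hk₄, hf₄, h8, hx₄, hy₄⟩
    refine ⟨hk₄, hHM.of_eq (hf₄ 0 (by decide) (by decide) (by decide) (by decide) (by decide))
      (hf₄ 1 (by decide) (by decide) (by decide) (by decide) (by decide)), fun i => ?_,
      Or.inr ⟨h8, t, Finset.mem_insert_self _ _, ?_, ?_, fun t' ht' => ?_⟩⟩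
    · rw [hf₄ _ (by unfold ctr; omega) (by unfold ctr; omega) (by unfold ctr; omega)
        (by unfold ctr; omega) (by unfold ctr; omega), Mem.put_of_ne _ _ _ (by unfold ctr; omega),
        hc₃]
    · rw [hx₄, Mem.vec_congr (Mem.put_of_ne _ _ _ (by decide)), hx₃]
    · rw [hy₄, Mem.vec_congr (Mem.put_of_ne _ _ _ (by decide)), hy₃]
    · rcases Finset.mem_insert.1 ht' with rfl | h
      · exact le_rfl
      · exact hT t' h
  refine Prog.meets_seq (Prog.meets_ifle (fun hle => Prog.meets_assign ?_)
    (fun hlt => Prog.meets_ask hq1 ?_))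
  · rcases hbest₃ with ⟨rfl, h8⟩ | ⟨h8, -⟩
    · refine Prog.meets_ifle (fun _ => hupdate 1 (by simp)) (fun hlt => ?_)
      simp [Mem.put_apply] at hlt
    · simp [h8] at hle
  · rcases hbest₃ with ⟨rfl, h8⟩ | ⟨h8, t₀, ht₀, hx, hy, hmax⟩
    · simp [h8] at hlt
    · refine Prog.meets_ifle (fun hle => hupdate _ ?_) (fun hlt' => Prog.meets_nop ?_)
      · have hlt'' : f (realVec (W.mulVec (X t₀))) < f (realVec (W.mulVec (X t))) := by
          by_contra h
          simp [multiOracle, Mem.put_apply, hy, hy₃, truth_eq_zero h] at hle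
        exact fun t' ht' => (hmax t' ht').trans hlt''.le
      · have hle'' : f (realVec (W.mulVec (X t))) ≤ f (realVec (W.mulVec (X t₀))) := by
          by_contra h
          simp [multiOracle, Mem.put_apply, hy, hy₃, truth_eq_one (not_le.1 h)] at hlt'
        refine ⟨rfl, hHM₃.of_eq (Mem.put_of_ne _ _ _ (by decide)) (Mem.put_of_ne _ _ _ (by decide)),
          fun i => ?_, Or.inr ⟨?_, t₀, Finset.mem_insert_of_mem ht₀, ?_, ?_, fun t' ht' => ?_⟩⟩
        · exact (Mem.put_of_ne _ _ _ (by unfold ctr; omega)).trans (hc₃ i)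
        · exact (congrFun (Mem.put_of_ne _ _ _ (by decide)) 0).trans h8
        · exact (Mem.vec_congr (Mem.put_of_ne _ _ _ (by decide))).trans hx
        · exact (Mem.vec_congr (Mem.put_of_ne _ _ _ (by decide))).trans hy
        · rcases Finset.mem_insert.1 ht' with rfl | h
          · exact hle''
          · exact hmax t' h

theorem representatives_succ (d p t : ℕ) [Decidable (IsRepresentative d p t)] :
    representatives d p (t + 1) = if IsRepresentative d p t then insert t (representatives d p t)
      else representatives d p t := by
  classical
  rw [representatives, Finset.range_add_one, Finset.filter_insert]
  split_ifs <;> rfl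

/-- After t points the incumbent is the best over the representatives below t, and their number is
the number of linear problems solved so far. -/
theorem multiProg_meets {X : ℕ → Fin n → ℤ} (hM : HoldsMulti p W M) (h8 : M 8 0 = 0)
    (hn : n ≤ L) (hd : d ≤ L) (hp : 2 * p + 1 ≤ L) (hb : 2 * chamberBound d p + 1 ≤ L)
    (hq : ∀ w : Fin n → ℤ, 1 + linTime G S w ≤ q)
    (hX : ∀ t, X t = linOutput G S (Matrix.vecMul (boxPoint d (chamberBound d p) t) W)) :
    (multiProg d).Meets (multiOracle G S f) (queryTime G S) querySolves L q M 0 fun M' k' =>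
      k' = (representatives d p (boxSize d p)).card ∧
      HoldsBest W f X (representatives d p (boxSize d p)) M' := by
  classical
  refine Prog.meets_nest (ctr_injective 0) hb (fun t M' k' =>
    k' = (representatives d p t).card ∧ HoldsMulti p W M' ∧
      HoldsBest W f X (representatives d p t) M') ?_ ?_ ?_ ?_ ?_
  · rintro t M' k' ⟨_, hM', _⟩
    exact eval_sideExpr (eval_chamberExpr hM'.2.1)
  · rintro t M' k' ⟨hk, hM', hbest⟩ i _ z
    have hne : ∀ b < 20, (M'.put (ctr 0 i) 0 z) b = M' b := fun b hb =>
      Mem.put_of_ne _ _ _ (ctr_ne_of_lt hb)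
    exact ⟨hk, hM'.of_eq (hne 0 (by decide)) (hne 1 (by decide)),
      hbest.of_eq (hne 2 (by decide)) (hne 6 (by decide)) (hne 8 (by decide))⟩
  · exact ⟨by simp [representatives], hM, Or.inl ⟨by simp [representatives], h8⟩⟩
  · rintro t ht M₁ k₁ ⟨hk₁, hM₁, hbest₁⟩ hdig
    refine Prog.meets_seq (Prog.Meets.mono (countProg_meets hp hb hM₁.2.1 hdig ht) ?_)
    rintro M₂ k₂ ⟨rfl, hf₂, hc₂, h9⟩
    have hM₂ := hM₁.of_eq (hf₂ 0 (by decide)) (hf₂ 1 (by decide))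
    have hbest₂ := hbest₁.of_eq (hf₂ 2 (by decide)) (hf₂ 6 (by decide)) (hf₂ 8 (by decide))
    have hiff := card_eq_one_iff_isRepresentative ht
    have hskip : ¬ IsRepresentative d p t → (k₂ = (representatives d p (t + 1)).card ∧
        HoldsMulti p W M₂ ∧ HoldsBest W f X (representatives d p (t + 1)) M₂) ∧
        ∀ i < d, M₂ (ctr 0 i) 0 = M₁ (ctr 0 i) 0 := fun hr => by
      rw [representatives_succ, if_neg hr]
      exact ⟨⟨hk₁, hM₂, hbest₂⟩, fun i _ => by rw [hc₂]⟩
    refine Prog.meets_ifle (fun hle => Prog.meets_ifle (fun hle' => ?_)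
      (fun hlt => Prog.meets_nop (hskip fun hr => ?_)))
      (fun hlt => Prog.meets_nop (hskip fun hr => ?_))
    · rw [Expr.eval_var, h9] at hle hle'
      simp only [Expr.eval] at hle hle'
      have hr := hiff.1 (by omega)
      refine Prog.Meets.mono (processProg_meets hM₂ hn hd hq hX
        (HoldsPoint.of_eq (M := M₁) hdig hc₂) hbest₂) ?_
      rintro M₃ k₃ ⟨hk₃, hM₃, hc₃, hbest₃⟩
      rw [representatives_succ, if_pos hr,
        Finset.card_insert_of_notMem (by simp [representatives])]
      exact ⟨⟨by rw [hk₃, hk₁], hM₃, hbest₃⟩, fun i _ => by rw [hc₃, hc₂]⟩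
    · rw [Expr.eval_var, h9, hiff.2 hr] at hlt
      simp at hlt
    · rw [Expr.eval_var, h9, hiff.2 hr] at hlt
      simp at hlt
  · rintro M' k' ⟨hk, _, hbest⟩
    exact ⟨hk, hbest⟩

/-- Distinct entries occupy distinct cells, by division of `i * n + j` with remainder by n. -/
theorem holdsMulti_multiInput (p : ℕ) (W : Matrix (Fin d) (Fin n) ℤ) :
    HoldsMulti p W (multiInput p W) := by
  refine ⟨arrayOf_apply ![(n : ℤ), (p : ℤ)] 0, arrayOf_apply ![(n : ℤ), (p : ℤ)] 1, fun i j => ?_⟩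
  refine Function.Injective.extend_apply (f := fun ij : Fin d × Fin n => (ij.1 : ℤ) * n + ij.2)
    ?_ (fun ij => W ij.1 ij.2) 0 (i, j)
  rintro ⟨i, j⟩ ⟨i', j'⟩ h
  have h' : (j : ℕ) + n * i = j' + n * i' := by
    have : (i : ℤ) * n + j = i' * n + j' := h
    have h2 : (((j : ℕ) + n * i : ℕ) : ℤ) = ((j' + n * i' : ℕ) : ℤ) := by
      push_cast; linarith
    exact_mod_cast h2
  have hn : 0 < n := j.pos
  have h1 := congrArg (· % n) h'
  have h2 := congrArg (· / n) h'
  simp only [Nat.add_mul_mod_self_left, Nat.mod_eq_of_lt j.2, Nat.mod_eq_of_lt j'.2] at h1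
  simp only [Nat.add_mul_div_left _ _ hn, Nat.div_eq_of_lt j.2, Nat.div_eq_of_lt j'.2,
    zero_add] at h2
  exact Prod.ext (Fin.ext h2) (Fin.ext h1)

end MultiProgram

/-! ### Assembly of the algorithm and its polynomial bound -/

section Main

theorem multiProg_spec (d : ℕ) {C₀ k₀ : ℕ}
    (hG : ∀ (n : ℕ) (S : Set (Fin n → ℤ)) (w : Fin n → ℤ), 0 < n →
      linTime greedyProg S w ≤ C₀ * n ^ k₀) :
    ∃ C k : ℕ, ∀ (n p : ℕ) (S : Set (Fin n → ℤ)) (W : Matrix (Fin d) (Fin n) ℤ)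
      (f : (Fin d → ℝ) → ℝ), 0 < n → 0 < p → IsMatroid S → IsBoundedUtility p W →
        ConvexOn ℝ Set.univ f →
          SolvesMulticriteria S W f (multiOutput (multiProg d) greedyProg p S W f) ∧
          multiTime (multiProg d) greedyProg p S W f ≤ C * (n + p) ^ k ∧
          multiSolves (multiProg d) greedyProg p S W f = numVertices d p := by
  obtain ⟨C₁, k₁, hA⟩ := (multiProg d).bound_le
  -- The factors come from the bounds `hLle` on the loop lengths and `hqle` on the query costs
  -- below. The power d + 1 dominates both n + p and p^d.
  refine ⟨C₁ * ((5 + d + 2 * d.factorial) * (1 + C₀)) ^ k₁, (d + 1 + k₀) * k₁,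
    fun n p S W f hn hp hS hW hf => ?_⟩
  -- The sum of all loop lengths that occur: columns, criteria, and the sides of the two boxes.
  set L := n + d + (2 * p + 1) + (2 * chamberBound d p + 1) with hL
  set q := 1 + C₀ * n ^ k₀ with hq
  have hqw : ∀ w : Fin n → ℤ, 1 + linTime greedyProg S w ≤ q := fun w =>
    Nat.add_le_add_left (hG n S w hn) 1
  obtain ⟨htime, hcount, hbest⟩ := multiProg_meets (G := greedyProg) (S := S) (W := W) (f := f)
    (L := L) (q := q) (holdsMulti_multiInput p W) rfl (by omega) (by omega) (by omega) (by omega)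
    hqw (fun _ => rfl)
  refine ⟨?_, ?_, ?_⟩
  · rcases hbest with ⟨hempty, -⟩ | ⟨-, t₀, -, hx, -, hmax⟩
    · exact absurd hempty (representatives_nonempty hp hS hW).ne_empty
    · have hout : multiOutput (multiProg d) greedyProg p S W f = _ := hx
      rw [hout]
      exact solvesMulticriteria_of_best hp hS hW hf
        (X := fun t => linOutput greedyProg S
          (Matrix.vecMul (boxPoint d (chamberBound d p) t) W))
        (fun t => by
          rw [linOutput_greedyProg]
          exact (isGreedySolution_greedyOrder S _).solvesLinear hS) hmax
  · have h1 : multiTime (multiProg d) greedyProg p S W f ≤ C₁ * (L * q) ^ k₁ :=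
      htime.trans (hA L q (by omega) (by omega))
    refine h1.trans ?_
    have hm : 1 ≤ n + p := by omega
    have hpow : ∀ a b : ℕ, a ≤ b → (n + p) ^ a ≤ (n + p) ^ b := fun a b h =>
      Nat.pow_le_pow_right hm h
    have hB : chamberBound d p ≤ d.factorial * (n + p) ^ (d + 1) :=
      Nat.mul_le_mul_left _ ((Nat.pow_le_pow_left (by omega) d).trans (hpow _ _ (by omega)))
    have hLle : L ≤ (5 + d + 2 * d.factorial) * (n + p) ^ (d + 1) := by
      have h2 : n + p ≤ (n + p) ^ (d + 1) := by simpa using hpow 1 (d + 1) (by omega)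
      have h3 : d ≤ d * (n + p) ^ (d + 1) := Nat.le_mul_of_pos_right d (by omega)
      have h4 : (5 + d + 2 * d.factorial) * (n + p) ^ (d + 1) = 5 * (n + p) ^ (d + 1) +
        d * (n + p) ^ (d + 1) + 2 * (d.factorial * (n + p) ^ (d + 1)) := by ring
      rw [h4]
      omega
    have hqle : q ≤ (1 + C₀) * (n + p) ^ k₀ := by
      have h2 : 1 ≤ (n + p) ^ k₀ := Nat.pow_pos hm
      have h3 : C₀ * n ^ k₀ ≤ C₀ * (n + p) ^ k₀ :=
        Nat.mul_le_mul_left _ (Nat.pow_le_pow_left (by omega) k₀)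
      rw [add_mul]; omega
    calc C₁ * (L * q) ^ k₁ ≤ C₁ * (((5 + d + 2 * d.factorial) * (n + p) ^ (d + 1)) *
          ((1 + C₀) * (n + p) ^ k₀)) ^ k₁ :=
          Nat.mul_le_mul_left _ (Nat.pow_le_pow_left (Nat.mul_le_mul hLle hqle) _)
      _ = _ := by rw [mul_mul_mul_comm, ← pow_add, mul_pow, ← pow_mul, mul_assoc]
  · rw [← card_representatives hp, ← hcount, zero_add]
    rfl

end Main

theorem mainTheorem2 (d : ℕ) (hd : 0 < d) :
    (∀ p : ℕ, 0 < p →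
      (∀ (n : ℕ) (S : Set (Fin n → ℤ)) (W : Matrix (Fin d) (Fin n) ℤ),
        0 < n → IsMatroid S → IsBoundedUtility p W →
          Refines (primitiveZonotope d p) (projPolytope W S)) ∧
      (∃ (n : ℕ) (S : Set (Fin n → ℤ)) (W : Matrix (Fin d) (Fin n) ℤ),
        0 < n ∧ IsMatroid S ∧ IsBoundedUtility p W ∧
          ∃ t : Fin d → ℝ, primitiveZonotope d p = (fun x => t + x) '' projPolytope W S) ∧
      IsGreatest
        {N : ℕ∞ | ∃ (n : ℕ) (S : Set (Fin n → ℤ)) (W : Matrix (Fin d) (Fin n) ℤ),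
          0 < n ∧ IsMatroid S ∧ IsBoundedUtility p W ∧
            N = (vertices (projPolytope W S)).encard}
        (numVertices d p : ℕ∞)) ∧
    ∃ (A : Prog MultiQuery) (G : Prog LinQuery) (C k : ℕ),
      (∀ (n : ℕ) (S : Set (Fin n → ℤ)) (w : Fin n → ℤ), 0 < n → IsMatroid S →
        IsGreedySolution S w (linOutput G S w) ∧ SolvesLinear S w (linOutput G S w) ∧
          linTime G S w ≤ C * n ^ k) ∧
      ∀ (n p : ℕ) (S : Set (Fin n → ℤ)) (W : Matrix (Fin d) (Fin n) ℤ) (f : (Fin d → ℝ) → ℝ),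
        0 < n → 0 < p → IsMatroid S → IsBoundedUtility p W → ConvexOn ℝ Set.univ f →
          SolvesMulticriteria S W f (multiOutput A G p S W f) ∧
          multiTime A G p S W f ≤ C * (n + p) ^ k ∧
          multiSolves A G p S W f = numVertices d p := by
  refine ⟨fun p hp => ⟨fun n S W _ hS hW => refines_projPolytope hS hW,
    exists_projPolytope_translate hd hp, isGreatest_encard_vertices hd hp⟩, ?_⟩
  obtain ⟨C₀, k₀, hG⟩ := exists_linTime_greedyProg_le
  obtain ⟨C, k, hA⟩ := multiProg_spec d hG
  -- One pair of constants serves both the subroutine and the main program.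
  have hmono : ∀ m : ℕ, 0 < m → C₀ * m ^ k₀ ≤ (C₀ + C) * m ^ (k₀ + k) ∧
      C * m ^ k ≤ (C₀ + C) * m ^ (k₀ + k) := fun m hm =>
    ⟨Nat.mul_le_mul (by omega) (Nat.pow_le_pow_right hm (by omega)),
      Nat.mul_le_mul (by omega) (Nat.pow_le_pow_right hm (by omega))⟩
  refine ⟨multiProg d, greedyProg, C₀ + C, k₀ + k, fun n S w hn hS => ?_,
    fun n p S W f hn hp hS hW hf => ?_⟩
  · have hgreedy : IsGreedySolution S w (linOutput greedyProg S w) := by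
      rw [linOutput_greedyProg]
      exact isGreedySolution_greedyOrder S w
    exact ⟨hgreedy, hgreedy.solvesLinear hS, (hG n S w hn).trans (hmono n hn).1⟩
  · obtain ⟨h1, h2, h3⟩ := hA n p S W f hn hp hS hW hf
    exact ⟨h1, h2.trans (hmono (n + p) (by omega)).2, h3⟩
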